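/- **Setting (GHAST protocol).** Blocks form a directed acyclic graph: besides the genesis block $\mathbf g$, every block $\mathbf b$ has a parent block and a list of referenced blocks; $\mathbf b.\mathsf{past}$ is the set of all its direct and indirect dependency blocks (parent and references, followed recursively), and $\mathrm{Chain}(\mathbf b)$ is the path of parents from $\mathbf g$ to $\mathbf b$. Write $\mathbf b_1\preceq\mathbf b_2$ if $\mathbf b_1\in\mathrm{Chain}(\mathbf b_2)$, and $\mathbf b_1\prec\mathbf b_2$ if moreover $\mathbf b_1\ne\mathbf b_2$. A random function gives each block a digest and from it a weight tag and a timer tag, which are $\kappa$-bit integers; a block is a *timer block* if its timer tag is $<2^\kappa/\eta_{\sf t}$, and *heavy-tagged* if its weight tag is $<2^\kappa/\eta_{\sf w}$. $\mathrm{TimerHeight}(\mathbf b)$ is $1$ plus the maximal timer height of a timer block in $\mathbf b.\mathsf{past}$ ($1$ if there is none), $\mathrm{MaxTH}(\mathbf B)$ is the maximal timer height of a timer block in $\mathbf B$ ($0$ if none), and $\mathrm{Old}(\mathbf B,\mathbf b)$ means $\mathrm{MaxTH}(\mathbf B)-\mathrm{TimerHeight}(\mathbf b)\ge\eta_{\sf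 b}$. For a set $\mathbf B$ of blocks, $\mathrm{Tree}(\mathbf B,\mathbf b)=\{\mathbf b'\in\mathbf B:\mathbf b\preceq\mathbf b'\}$, $\mathrm{TotalW}$ is the sum of weights, $\mathrm{SubTW}(\mathbf B,\mathbf b)=\mathrm{TotalW}(\mathrm{Tree}(\mathbf B,\mathbf b))$, the children of $\mathbf b$ in $\mathbf B$ are the blocks of $\mathbf B$ of positive weight with parent $\mathbf b$, and $\mathrm{SibSubTW}(\mathbf B,\mathbf b)$ is the maximal $\mathrm{SubTW}(\mathbf B,\cdot)$ of the other children of the parent of $\mathbf b$ ($0$ if none). $\mathrm{Pivot}(\mathbf B)$ starts at $\mathbf g$ and repeatedly goes to the child with maximal subtree weight (ties: smallest digest). $\mathrm{Adapt}(\mathbf B)=\mathsf{con}$ if $\mathbf B\neq\emptyset$ and either some $\mathbf b\in\mathrm{Pivot}(\mathbf B)\setminus\{\mathbf g\}$ has $\mathrm{Old}(\mathbf B,\mathbf b.\mathsf{parent})$ and $\mathrm{SubTW}(\mathbf B,\mathbf b)-\mathrm{SibSubTW}(\mathbf B,\mathbf b)<\eta_{\sf a}$, or the last block of $\mathrm{Pivot}(\mathbf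 B)$ is old in $\mathbf B$; otherwise it is $\mathsf{opt}$. The weight of $\mathbf b$ is $1$ if $\mathrm{Adapt}(\mathbf b.\mathsf{past})=\mathsf{opt}$; otherwise it is $\eta_{\sf w}$ if $\mathbf b$ is heavy-tagged and $0$ if not. A non-genesis block is *valid* if its digest is $<2^\kappa/\eta_{\sf d}$ and its parent is the last block of $\mathrm{Pivot}(\mathbf b.\mathsf{past})$; $\mathbf g$ is valid. A *graph* is a finite set of valid blocks containing all dependency blocks of its members. **Execution.** The protocol runs in rounds with $m$ nodes; in each round the adversary chooses which nodes are honest, then delivers blocks to nodes, then new blocks are generated. The local state of an honest node is a graph containing $\mathbf g$ (initially $\{\mathbf g\}$). A new block of an honest node has the node's local state as its past; the adversary may generate any new valid block on generated blocks. A block that is in the local state of an honest node in round $r$ is, once delivery in round $r+d$ is over, in the local states of all honest nodes from then on. The events $e=(r,\mathbf b,t)$ are: generation of $\mathbf b$ by an honest node ($\mathsf{hGenRls}$); generation by the adversary ($\mathsf{mGen}$); first appearance of a malicious block in an honest local state ($\mathsf{mRls}$); arrival at all honest nodes ($\mathsf{Arvl}$), which happens at the delivery of round $r+d$ if $r$ is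 the first round in which $\mathbf b$ is in an honest local state, dependency blocks first. **Adversary state.** $\mathcal S=(\mathbf G^{\sf gen},\mathbf G^{\sf max},\mathbf G^{\sf min},\mathbf M,\mathbf f,\mathbf C,\mathbf S,v)$ is initially $(\{\mathbf g\},\{\mathbf g\},\{\mathbf g\},\emptyset,\bot,(\mathbf g),\emptyset,0)$; $\mathbf G^\Delta:=\mathbf G^{\sf max}\setminus\mathbf G^{\sf min}$, $\mathrm{Tip}(\mathbf C)$ is the last block of the chain $\mathbf C$, and $\mathrm{Next}(\mathbf C,\mathbf b)$ is the block after $\mathbf b$ in $\mathbf C$ ($\bot$ if there is none). With integers $s_{\sf m},s_{\sf h}\ge0$, $\mathrm{Spe}(\mathcal S)$ holds iff $\mathrm{SubTW}(\mathbf G^\Delta\cap\mathbf M,\mathrm{Tip}(\mathbf C))\ge s_{\sf m}$, or at least $s_{\sf h}$ blocks of $\mathbf G^\Delta\setminus\mathbf M$ have weight $1$, or at least $3$ of them have weight $\eta_{\sf w}$. Let $\mathrm{Adv}(\mathcal S,\mathbf b)=\mathrm{SubTW}(\mathbf G^{\sf min}\cup\{\mathbf f\},\mathbf b)-\mathrm{SibSubTW}(\mathbf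 G^{\sf max},\mathbf b)$, with $\{\bot\}=\emptyset$. An event $e$ updates $\mathcal S_{-}$ to $\mathcal S$ as follows. * $e.\mathsf{block}$ is added to $\mathbf G^{\sf gen},\mathbf G^{\sf max}$ (if $\mathsf{hGenRls}$), to $\mathbf G^{\sf gen},\mathbf M$ ($\mathsf{mGen}$), to $\mathbf G^{\sf max}$ ($\mathsf{mRls}$), to $\mathbf G^{\sf min}$ ($\mathsf{Arvl}$). * If $e$ is $\mathsf{hGenRls}$ of a block of weight $\eta_{\sf w}$: $\mathbf f=e.\mathsf{block}$ if $\mathrm{Spe}(\mathcal S_{-})$ fails and $\mathbf G^\Delta_{-}\setminus\mathbf M_{-}$ has no block of weight $\eta_{\sf w}$; otherwise $\mathbf f=\bot$ if $\mathbf f_{-}\ne\bot$. If $e$ is $\mathsf{Arvl}$ of $\mathbf f_{-}$, $\mathbf f=\bot$. Otherwise $\mathbf f=\mathbf f_{-}$. * $\mathbf C$ starts at $\mathbf g$ and repeatedly goes to the child in $\mathbf G^{\sf max}$ with $\mathrm{Adv}(\mathcal S,\cdot)>0$ as long as there is one; it is then cut off before its first block $\mathbf b'$ with $\mathrm{Tip}(\mathbf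 C_{-})\prec\mathbf b'$ and $\mathrm{Adv}(\mathcal S,\mathbf b')\le s_{\sf m}+s_{\sf h}$. * $\mathbf S=\mathbf S_{-}\cup(\mathrm{Tree}(\mathbf G^\Delta,\mathrm{Tip}(\mathbf C))\cap\mathbf M)$ and $v=v_{-}+\min\{s_{\sf m},\mathrm{TotalW}(\mathbf S\setminus\mathbf S_{-})\}$. **Potential.** If $\mathbf b\in\mathbf C$ and $\mathrm{Old}(\mathbf G^{\sf min},\mathbf b)$, then, with $\mathbf c=\mathrm{Next}(\mathbf C,\mathbf b)$, $P(\mathcal S,\mathbf b)$ is $\mathrm{SubTW}(\mathbf G^{\sf gen}\setminus\mathbf G^{\sf max},\mathbf b)$ plus, if $\mathbf c\neq\bot$, $$s_{\sf h}+s_{\sf m}-\mathrm{Adv}(\mathcal S,\mathbf c)-\min\{\mathrm{TotalW}(\mathrm{Tree}(\mathbf G^\Delta,\mathbf c)\cap\mathbf N),s_{\sf h}\}+\mathrm{TotalW}((\mathrm{Tree}(\mathbf G^\Delta,\mathbf c)\cap\mathbf M)\setminus\mathbf S),$$ where $\mathbf N$ is the set of blocks of weight $1$ in $\mathbf G^{\sf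 max}\setminus\mathbf M$; otherwise $P(\mathcal S,\mathbf b)=\bot$. $\tilde P(\mathcal S,\mathbf B)$ is the maximum of the values $P(\mathcal S,\mathbf b)\ne\bot$ over $\mathbf b\in\mathbf C$ with $\mathbf B\nsubseteq\mathbf b.\mathsf{past}$, and $0$ if there are none. **Event value.** $\Delta(\mathcal S_{-},e)$ is $0$ for $\mathsf{mRls}$ and $\mathsf{Arvl}$, and the weight of $e.\mathsf{block}$ for $\mathsf{mGen}$. For $\mathsf{hGenRls}$ it is: $0$ for weight $0$; for weight $1$, $0$ if $\mathrm{Spe}(\mathcal S_{-})$ and $-1$ otherwise; for weight $\eta_{\sf w}$, if $\mathbf G^\Delta_{-}\setminus\mathbf M_{-}$ has no block of weight $\eta_{\sf w}$, $0$ if $\mathrm{Spe}(\mathcal S_{-})$ and $2s_{\sf h}+2s_{\sf m}-\eta_{\sf w}$ otherwise; and if it has such a block, $0$ if $\mathbf f_{-}=\bot$ and $\eta_{\sf w}+s_{\sf m}$ otherwise. **Theorem.** Let $\eta_{\sf w}>0$, $\eta_{\sf b}\ge0$, $2s_{\sf h}+2s_{\sf m}\le\eta_{\sf w}$ and $2s_{\sf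 m}+2s_{\sf h}+2\eta_{\sf w}\le\eta_{\sf a}$. Let $\mathcal S$ be an adversary state appearing in an execution of the protocol, $\mathcal S_{-}$ the previous adversary state, and $e$ the event that updates $\mathcal S_{-}$ to $\mathcal S$. Let $\mathbf B$ be a non-empty graph. Assume that $\mathrm{Old}(\mathbf G^{\sf min}_{-},\mathbf g)$ holds and that every $\mathbf b\in\mathbf C$ with $\mathbf B\nsubseteq\mathbf b.\mathsf{past}$ satisfies $$\neg\,\mathrm{Old}(\mathbf G^{\sf min},\mathbf b)\ \vee\ \mathrm{Old}(\mathbf G^{\sf min}_{-},\mathbf b)\ \vee\ \tilde P(\mathcal S,\mathbf B)\neq P(\mathcal S,\mathbf b).$$ Then $$(\tilde P(\mathcal S,\mathbf B)+v)-(\tilde P(\mathcal S_{-},\mathbf B)+v_{-})\le\Delta(\mathcal S_{-},e).$$ -/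

import Mathlib

noncomputable section

namespace Ghast

/-! ### Blocks and parameters

A hash pointer is identified with the block it points to, so that a block is built from its parent
block, its list of referenced blocks, its contents `m` and its nonce `s`. -/

inductive Block : Type
  | genesis : Block
  | mk (parent : Block) (n : ℕ) (refs : Fin n → Block) (content nonce : List Bool) : Block

/-- Protocol parameters, analysis parameters `sm`, `sh`, maximum network delay, and one outcome of
the random function: `H` produces digests (`none` stands for the input of the genesis block),
`Hweight` and `Htimer` produce the two random tags from a digest. -/
structure Params where
  κ : ℕ
  ηd : ℝ
  ηw : ℝ
  ηa : ℝ
  ηt : ℝ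
  ηb : ℝ
  sm : ℕ
  sh : ℕ
  delay : ℕ
  H : Option (Fin (2 ^ κ) × List (Fin (2 ^ κ)) × List Bool × List Bool) → Fin (2 ^ κ)
  Hweight : Fin (2 ^ κ) → Fin (2 ^ κ)
  Htimer : Fin (2 ^ κ) → Fin (2 ^ κ)

open Classical in
instance : DecidableEq Block := fun a b => propDecidable (a = b)

namespace Block

def parent : Block → Option Block
  | genesis => none
  | mk p _ _ _ _ => some p

/-- All direct and indirect dependency blocks. -/
def past : Block → Finset Block
  | genesis => ∅
  | mk p _ refs _ _ =>
      insert p (past p) ∪ Finset.univ.biUnion (fun i => insert (refs i) (past (refs i)))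

/-- The path of parent links from the genesis block to the given block. -/
def chain : Block → List Block
  | genesis => [genesis]
  | mk p n refs m s => chain p ++ [mk p n refs m s]

/-- Length of a longest dependency path; only used to justify recursion along `past`. -/
def height : Block → ℕ
  | genesis => 0
  | mk p _ refs _ _ => max (height p) (Finset.univ.sup (fun i => height (refs i))) + 1

theorem height_lt_of_mem_past : ∀ (b : Block) {b' : Block}, b' ∈ b.past → b'.height < b.height
  | genesis, b', h => by simp [past] at h
  | mk p n refs m s, b', h => by
      simp only [past, Finset.mem_union, Finset.mem_insert, Finset.mem_biUnion,
        Finset.mem_univ, true_and] at h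
      have hp : p.height ≤ max (height p) (Finset.univ.sup (fun i => height (refs i))) :=
        le_max_left _ _
      have hr : ∀ i, (refs i).height ≤
          max (height p) (Finset.univ.sup (fun i => height (refs i))) := fun i =>
        le_trans (Finset.le_sup (f := fun i => height (refs i)) (Finset.mem_univ i))
          (le_max_right _ _)
      simp only [height]
      rcases h with (rfl | h) | ⟨i, rfl | h⟩
      · omega
      · have := height_lt_of_mem_past p h
        omega
      · have := hr i
        omega
      · have := height_lt_of_mem_past (refs i) h
        have := hr i
        omega

def digest (P : Params) : Block → Fin (2 ^ P.κ)
  | genesis => P.H none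
  | mk p _ refs m s =>
      P.H (some (digest P p, List.ofFn (fun i => digest P (refs i)), m, s))

end Block

open Block

/-- `b₁ ⪯ b₂`. -/
def Preceq (b₁ b₂ : Block) : Prop := b₁ ∈ b₂.chain

/-- `b₁ ≺ b₂`. -/
def Prec (b₁ b₂ : Block) : Prop := Preceq b₁ b₂ ∧ b₁ ≠ b₂

/-! ### Block age -/

def IsTimer (P : Params) (b : Block) : Prop :=
  ((P.Htimer (b.digest P) : ℕ) : ℝ) < 2 ^ P.κ / P.ηt

open Classical in
/-- One plus the maximal height of a timer block of the past; `1` if there is none. -/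
def timerHeight (P : Params) (b : Block) : ℕ :=
  (b.past.attach.filter (fun x => IsTimer P x.1)).sup (fun x => timerHeight P x.1) + 1
termination_by b.height
decreasing_by exact height_lt_of_mem_past b x.2

open Classical in
/-- Maximal height of a timer block of `B`; `0` if there is none. -/
def maxTH (P : Params) (B : Finset Block) : ℕ :=
  (B.filter (IsTimer P)).sup (timerHeight P)

def Old (P : Params) (B : Finset Block) (b : Block) : Prop :=
  P.ηb ≤ (maxTH P B : ℝ) - (timerHeight P b : ℝ)

/-! ### Weighted trees, relative to a weight assignment `w` -/

def totalW (w : Block → ℝ) (T : Finset Block) : ℝ := ∑ b ∈ T, w b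

open Classical in
def tree (B : Finset Block) (b : Block) : Finset Block := B.filter (fun b' => Preceq b b')

def subTW (w : Block → ℝ) (B : Finset Block) (b : Block) : ℝ := totalW w (tree B b)

open Classical in
/-- The blocks of `B` with parent `p` and positive weight (`p = none`: no parent). -/
def children (w : Block → ℝ) (B : Finset Block) (p : Option Block) : Finset Block :=
  B.filter (fun b' => b'.parent = p ∧ 0 < w b')

open Classical in
/-- Maximal subtree weight of a sibling; `0` if there is no sibling. -/
def sibSubTW (w : Block → ℝ) (B : Finset Block) (b : Block) : ℝ :=
  if h : ((children w B b.parent).erase b).Nonempty then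
    ((children w B b.parent).erase b).sup' h (subTW w B) else 0

open Classical in
/-- Child of maximal subtree weight, ties broken by the smaller digest. -/
def bestChild (P : Params) (w : Block → ℝ) (B : Finset Block) (b : Block) : Option Block :=
  let best := (children w B (some b)).filter
    (fun c => ∀ c' ∈ children w B (some b), subTW w B c' ≤ subTW w B c)
  let cands := best.filter (fun c => ∀ c' ∈ best, c.digest P ≤ c'.digest P)
  if h : cands.Nonempty then some h.choose else none

/-- The blocks reached from the genesis block by iterating `next`. -/
inductive Reached (next : Block → Option Block) : Block → Prop
  | genesis : Reached next genesis
  | step {b c : Block} : Reached next b → next b = some c → Reached next c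

/-- `b` lies on the pivot chain of `B`. -/
def InPivot (P : Params) (w : Block → ℝ) (B : Finset Block) : Block → Prop :=
  Reached (bestChild P w B)

/-- `b` is the last block of the pivot chain of `B`. -/
def IsPivotTip (P : Params) (w : Block → ℝ) (B : Finset Block) (b : Block) : Prop :=
  InPivot P w B b ∧ bestChild P w B b = none

/-! ### Adaptive block weights -/

inductive Strategy
  | opt
  | con

open Classical in
def adapt (P : Params) (w : Block → ℝ) (B : Finset Block) : Strategy :=
  if B.Nonempty ∧
      ((∃ b p, InPivot P w B b ∧ b.parent = some p ∧ Old P B p ∧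
          subTW w B b - sibSubTW w B b < P.ηa) ∨
        ∃ b, IsPivotTip P w B b ∧ Old P B b)
  then .con else .opt

open Classical in
def weightUnder (P : Params) (s : Strategy) (b : Block) : ℝ :=
  match s with
  | .opt => 1
  | .con => if ((P.Hweight (b.digest P) : ℕ) : ℝ) < 2 ^ P.κ / P.ηw then P.ηw else 0

open Classical in
/-- The weight of a block, by recursion along its past; `weight_eq` is the defining equation. -/
def weight (P : Params) (b : Block) : ℝ :=
  weightUnder P
    (adapt P (fun b' => if _h : b' ∈ b.past then weight P b' else 0) b.past) b
termination_by b.height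
decreasing_by exact height_lt_of_mem_past b _h

theorem subTW_congr {w w' : Block → ℝ} {B : Finset Block} (h : ∀ b ∈ B, w b = w' b) :
    subTW w B = subTW w' B := by
  funext b
  refine Finset.sum_congr rfl fun x hx => h x ?_
  simp only [tree, Finset.mem_filter] at hx
  exact hx.1

theorem children_congr {w w' : Block → ℝ} {B : Finset Block} (h : ∀ b ∈ B, w b = w' b) :
    children w B = children w' B := by
  funext p
  ext x
  simp only [children, Finset.mem_filter]
  exact and_congr_right fun hx => by rw [h x hx]

theorem adapt_congr (P : Params) {w w' : Block → ℝ} {B : Finset Block}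
    (h : ∀ b ∈ B, w b = w' b) : adapt P w B = adapt P w' B := by
  have h1 := subTW_congr h
  have h2 := children_congr h
  have h3 : sibSubTW w B = sibSubTW w' B := by
    funext b
    simp only [sibSubTW, h1, h2]
  have h4 : bestChild P w B = bestChild P w' B := by
    funext b
    simp only [bestChild, h1, h2]
  unfold adapt IsPivotTip InPivot
  rw [h1, h3, h4]

theorem weight_eq (P : Params) (b : Block) :
    weight P b = weightUnder P (adapt P (weight P) b.past) b := by
  rw [weight]
  congr 1
  exact adapt_congr P fun x hx => by simp [hx]

/-! ### Validity -/

/-- Proof of work is solved, and the parent is the last block of the pivot chain of the past. -/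
def Valid (P : Params) (b : Block) : Prop :=
  match b.parent with
  | none => True
  | some p => ((b.digest P : ℕ) : ℝ) < 2 ^ P.κ / P.ηd ∧ IsPivotTip P (weight P) b.past p

/-- A valid graph: a set of valid blocks containing all dependency blocks of its members. -/
def IsGraph (P : Params) (B : Finset Block) : Prop :=
  ∀ b ∈ B, Valid P b ∧ b.past ⊆ B

/-! ### Events and the adversary state -/

inductive EventType
  | hGenRls
  | mGen
  | mRls
  | arvl

structure Event where
  round : ℕ
  block : Block
  type : EventType

structure AdvState where
  Ggen : Finset Block
  Gmax : Finset Block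
  Gmin : Finset Block
  M : Finset Block
  f : Option Block
  C : List Block
  S : Finset Block
  v : ℝ

def AdvState.Gdelta (S : AdvState) : Finset Block := S.Gmax \ S.Gmin

def AdvState.initial : AdvState where
  Ggen := {genesis}
  Gmax := {genesis}
  Gmin := {genesis}
  M := ∅
  f := none
  C := [genesis]
  S := ∅
  v := 0

/-- Last block of a (non-empty) chain. -/
def tip (C : List Block) : Block := C.getLastD genesis

/-- Next block after `b` in the parent/child chain `C`. -/
def next (C : List Block) (b : Block) : Option Block :=
  C.find? (fun c => decide (c.parent = some b))

/-- The honest blocks of `GΔ` of weight `x`. -/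
def AdvState.honestDelta (P : Params) (S : AdvState) (x : ℝ) : Finset Block :=
  open Classical in (S.Gdelta \ S.M).filter (fun b => weight P b = x)

/-- Special status. -/
def Spe (P : Params) (S : AdvState) : Prop :=
  (P.sm : ℝ) ≤ subTW (weight P) (S.Gdelta ∩ S.M) (tip S.C) ∨
  P.sh ≤ (S.honestDelta P 1).card ∨
  3 ≤ (S.honestDelta P P.ηw).card

def adv (P : Params) (Gmax Gmin : Finset Block) (f : Option Block) (b : Block) : ℝ :=
  subTW (weight P) (Gmin ∪ f.toFinset) b - sibSubTW (weight P) Gmax b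

def AdvState.adv (P : Params) (S : AdvState) (b : Block) : ℝ :=
  Ghast.adv P S.Gmax S.Gmin S.f b

open Classical in
/-- The flag block after event `e`. -/
def nextFlag (P : Params) (S : AdvState) (e : Event) : Option Block :=
  match e.type with
  | .hGenRls =>
      if weight P e.block = P.ηw ∧ ¬ Spe P S ∧ S.honestDelta P P.ηw = ∅ then some e.block
      else if weight P e.block = P.ηw ∧ S.f ≠ none then none
      else S.f
  | .arvl => if S.f = some e.block then none else S.f
  | .mGen => S.f
  | .mRls => S.f

open Classical in
/-- A child of `b` in `G` at which `a` is positive, if there is one. -/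
def positiveChild (P : Params) (a : Block → ℝ) (G : Finset Block) (b : Block) : Option Block :=
  if h : ∃ c ∈ children (weight P) G (some b), 0 < a c then some h.choose else none

/-- The chain obtained from `b` by visiting positive children repeatedly, at most `n` times. -/
def growChain (P : Params) (a : Block → ℝ) (G : Finset Block) : ℕ → Block → List Block
  | 0, b => [b]
  | n + 1, b =>
      match positiveChild P a G b with
      | none => [b]
      | some c => b :: growChain P a G n c

open Classical in
/-- The new variant of the common pivot chain, where `Cprev` is the previous one: the chain of
positive children starting at the genesis block (it has at most `Gmax.card` steps, since every step
reaches a new block of `Gmax`), cut off before the first block that lies strictly beyond the tip of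
`Cprev` and has an advantage of at most `sm + sh`. -/
def nextChain (P : Params) (Gmax Gmin : Finset Block) (f : Option Block) (Cprev : List Block) :
    List Block :=
  (growChain P (adv P Gmax Gmin f) Gmax Gmax.card genesis).takeWhile
    (fun b => decide (¬ (Prec (tip Cprev) b ∧ adv P Gmax Gmin f b ≤ (P.sm : ℝ) + P.sh)))

/-- The traverse function `ψ`. -/
def traverse (P : Params) (S : AdvState) (e : Event) : AdvState :=
  let Ggen := match e.type with
    | .hGenRls | .mGen => insert e.block S.Ggen
    | .mRls | .arvl => S.Ggen
  let Gmax := match e.type with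
    | .hGenRls | .mRls => insert e.block S.Gmax
    | .mGen | .arvl => S.Gmax
  let Gmin := match e.type with
    | .arvl => insert e.block S.Gmin
    | .hGenRls | .mGen | .mRls => S.Gmin
  let M := match e.type with
    | .mGen => insert e.block S.M
    | .hGenRls | .mRls | .arvl => S.M
  let f := nextFlag P S e
  let C := nextChain P Gmax Gmin f S.C
  let S' := S.S ∪ (tree (Gmax \ Gmin) (tip C) ∩ M)
  { Ggen := Ggen
    Gmax := Gmax
    Gmin := Gmin
    M := M
    f := f
    C := C
    S := S'
    v := S.v + min (P.sm : ℝ) (totalW (weight P) (S' \ S.S)) }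

/-! ### Potential values and event values -/

def potWith (P : Params) (S : AdvState) (b : Block) : ℝ :=
  subTW (weight P) (S.Ggen \ S.Gmax) b

open Classical in
def potAdv (P : Params) (S : AdvState) (c : Option Block) : ℝ :=
  match c with
  | none => 0
  | some c =>
      (P.sh : ℝ) + P.sm - S.adv P c -
        min (totalW (weight P)
          (tree S.Gdelta c ∩ (S.Gmax \ S.M).filter (fun b' => weight P b' = 1))) P.sh

def potSp (P : Params) (S : AdvState) (b : Block) : ℝ :=
  match next S.C b with
  | none => 0
  | some c => totalW (weight P) ((tree S.Gdelta c ∩ S.M) \ S.S)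

open Classical in
/-- The block potential value; `none` stands for `⊥`. -/
def blockPot (P : Params) (S : AdvState) (b : Block) : Option ℝ :=
  if b ∈ S.C ∧ Old P S.Gmin b then
    some (potWith P S b + potAdv P S (next S.C b) + potSp P S b)
  else none

open Classical in
/-- The maximum of the block potential values different from `⊥` among the blocks `b` of the chain
with `B ⊄ b.past`; `0` if there is no such value. -/
def globalPot (P : Params) (S : AdvState) (B : Finset Block) : ℝ :=
  let vals : Finset ℝ := (S.C.toFinset.filter (fun b => ¬ B ⊆ b.past)).biUnion
    (fun b => (blockPot P S b).toFinset)
  if h : vals.Nonempty then vals.max' h else 0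

open Classical in
/-- The event value `Δ(S, e)`. -/
def eventValue (P : Params) (S : AdvState) (e : Event) : ℝ :=
  match e.type with
  | .mRls => 0
  | .arvl => 0
  | .mGen => weight P e.block
  | .hGenRls =>
      if weight P e.block = 0 then 0
      else if weight P e.block = 1 then (if Spe P S then 0 else -1)
      else if S.honestDelta P P.ηw = ∅ then
        (if Spe P S then 0 else 2 * (P.sh : ℝ) + 2 * P.sm - P.ηw)
      else if S.f = none then 0
      else P.ηw + P.sm

/-! ### Executions of the protocol with `m` nodes

Each round has a delivery phase (corruptions change, the adversary delivers blocks, due arrival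
events happen) and a mining phase (blocks are generated). -/

inductive Phase
  | deliver
  | mine

/-- `view i` is the local state of node `i` (meaningful while `i` is honest), `firstSeen b` the
round in which `b ∈ Gmax` first appeared in the local state of an honest node. -/
structure Config (m : ℕ) where
  round : ℕ
  phase : Phase
  honest : Finset (Fin m)
  view : Fin m → Finset Block
  firstSeen : Block → ℕ
  state : AdvState

def Config.initial {m : ℕ} (honest : Finset (Fin m)) : Config m where
  round := 0
  phase := .deliver
  honest := honest
  view := fun _ => {genesis}
  firstSeen := fun _ => 0
  state := AdvState.initial

/-- One step of an execution, labelled with the event it causes, if any. -/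
inductive Step (P : Params) {m : ℕ} : Config m → Option Event → Config m → Prop
  /-- A new round begins and the adversary chooses the corrupted nodes. A node that stays honest
  keeps its local state. A node that becomes honest has some valid graph as local state; blocks in
  it that no honest node has had before count as delivered afterwards. -/
  | newRound (c : Config m) (honest' : Finset (Fin m)) (view' : Fin m → Finset Block)
      (hphase : c.phase = .mine)
      (hkeep : ∀ i ∈ honest', i ∈ c.honest → view' i = c.view i)
      (hjoin : ∀ i ∈ honest', i ∉ c.honest →
        IsGraph P (view' i) ∧ genesis ∈ view' i ∧ view' i ⊆ c.state.Gmax) :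
      Step P c none
        { c with round := c.round + 1, phase := .deliver, honest := honest', view := view' }
  /-- An honest node receives a block that some honest node has had before. -/
  | deliver (c : Config m) (i : Fin m) (b : Block)
      (hphase : c.phase = .deliver) (hi : i ∈ c.honest)
      (hb : b ∈ c.state.Gmax) (hpast : b.past ⊆ c.view i) :
      Step P c none { c with view := Function.update c.view i (insert b (c.view i)) }
  /-- An honest node is the first one to receive a malicious block. -/
  | release (c : Config m) (i : Fin m) (b : Block)
      (hphase : c.phase = .deliver) (hi : i ∈ c.honest)
      (hb : b ∈ c.state.Ggen) (hnew : b ∉ c.state.Gmax) (hpast : b.past ⊆ c.view i) :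
      Step P c (some ⟨c.round, b, .mRls⟩)
        { c with
          view := Function.update c.view i (insert b (c.view i))
          firstSeen := Function.update c.firstSeen b c.round
          state := traverse P c.state ⟨c.round, b, .mRls⟩ }
  /-- A block that appeared at an honest node `delay` rounds ago has reached all honest nodes. -/
  | arrive (c : Config m) (b : Block)
      (hphase : c.phase = .deliver)
      (hb : b ∈ c.state.Gmax) (hnew : b ∉ c.state.Gmin)
      (hdue : c.firstSeen b + P.delay ≤ c.round)
      (hall : ∀ i ∈ c.honest, b ∈ c.view i) (hpast : b.past ⊆ c.state.Gmin) :
      Step P c (some ⟨c.round, b, .arvl⟩)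
        { c with state := traverse P c.state ⟨c.round, b, .arvl⟩ }
  /-- The delivery phase ends; all arrivals that are due must have happened, and all honest nodes
  must have the blocks concerned. -/
  | startMining (c : Config m)
      (hphase : c.phase = .deliver)
      (hdue : ∀ b ∈ c.state.Gmax, c.firstSeen b + P.delay ≤ c.round →
        b ∈ c.state.Gmin ∧ ∀ i ∈ c.honest, b ∈ c.view i) :
      Step P c none { c with phase := .mine }
  /-- An honest node generates a new block whose past is its local state. -/
  | honestGenerate (c : Config m) (i : Fin m) (b : Block)
      (hphase : c.phase = .mine) (hi : i ∈ c.honest)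
      (hnew : b ∉ c.state.Ggen) (hpast : b.past = c.view i) (hvalid : Valid P b) :
      Step P c (some ⟨c.round, b, .hGenRls⟩)
        { c with
          view := Function.update c.view i (insert b (c.view i))
          firstSeen := Function.update c.firstSeen b c.round
          state := traverse P c.state ⟨c.round, b, .hGenRls⟩ }
  /-- The adversary generates a new block. -/
  | maliciousGenerate (c : Config m) (b : Block)
      (hphase : c.phase = .mine)
      (hnew : b ∉ c.state.Ggen) (hpast : b.past ⊆ c.state.Ggen) (hvalid : Valid P b) :
      Step P c (some ⟨c.round, b, .mGen⟩)
        { c with state := traverse P c.state ⟨c.round, b, .mGen⟩ }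

/-- The configurations that appear in executions. -/
inductive Reachable (P : Params) {m : ℕ} : Config m → Prop
  | initial (honest : Finset (Fin m)) : Reachable P (Config.initial honest)
  | step {c c' : Config m} {e : Option Event} :
      Reachable P c → Step P c e c' → Reachable P c'

end Ghast

end

/-! The global claim reduces to a claim about single blocks, `PotBound`: every block `b` of the new
chain that was already old before the event has an ancestor `b'` on the old chain such that the
potential of `b` afterwards, plus the increase of `v`, is at most the potential of `b'` before, plus
the event value. Ancestors inherit age, and their pasts are smaller, so `b'` competes in the old
maximum. The exceptional hypothesis makes a maximiser of the new potential a block that was already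
old, and `genesis` guarantees that a maximiser exists. `PotBound` is proved event by event
(`potBound_mGen`, `potBound_mRls`, `potBound_arvl`, `potBound_hGenRls`).

The potential is an account in which weight changes category. Malicious generation creates withheld
weight, which is the cost of the event. Release turns withheld weight into undelivered malicious
weight or into lost advantage. Arrival turns undelivered honest weight into advantage. Malicious
weight that enters the set of special blocks is exchanged for `v` (`specialW_traverse_le`). When the
chain grows, the blocks beyond the old tip have advantage above `sm + sh`, so their potential does
not exceed that of the old tip; when it is cut, the first lost block has advantage at most `0`.

For honest blocks the question is whether the new block `x` extends the chain. Its past lies between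
`Gmin` and `Gmax`, and the advantage is the lead of a block measured pessimistically over all graphs
in between. Hence without a flag block `x` lies below the whole chain (`preceq_of_flag_none`). If
`x` is generated under the optimistic strategy, its past shows leads of at least `ηa` below old
blocks, which outweighs the flag, so `x` follows the old part of the chain (`preceq_of_opt`).
Outside special status the undelivered weight below the tip is less than `sm + sh + 2 * ηw`
(`subTW_gdelta_lt`), so by `lead_le` a lead of `ηa` would extend the chain: the tip is not old, and
a block of weight `1` lowers the potential at every old block of the chain by `1`. A heavy block
that becomes the flag raises all advantages on its path by `ηw` and brings the chain down to itself.
Removing a flag costs at most its weight. -/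

namespace Ghast

open Block

/-! ### The ancestor order -/

theorem chain_eq_of_parent {b p : Block} (h : b.parent = some p) : b.chain = p.chain ++ [b] := by
  cases b with
  | genesis => simp [parent] at h
  | mk q n refs m s =>
    simp only [parent, Option.some.injEq] at h
    subst h
    rfl

theorem parent_eq_none {b : Block} : b.parent = none ↔ b = genesis := by
  cases b <;> simp [parent]

theorem exists_parent {b : Block} (h : b ≠ genesis) : ∃ p, b.parent = some p := by
  cases b with
  | genesis => exact absurd rfl h
  | mk q n refs m s => exact ⟨q, rfl⟩

theorem ne_genesis_of_parent {b p : Block} (h : b.parent = some p) : b ≠ genesis := by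
  rintro rfl
  simp [parent] at h

theorem parent_mem_past {b p : Block} (h : b.parent = some p) : p ∈ b.past := by
  cases b with
  | genesis => simp [parent] at h
  | mk q n refs m s =>
    simp only [parent, Option.some.injEq] at h
    subst h
    simp [past]

-- The tree order depends on parent links only, so this induction forgets the hypotheses on
-- referenced blocks.
@[elab_as_elim]
theorem parent_induction {motive : Block → Prop} (b : Block) (genesis : motive genesis)
    (step : ∀ b p, b.parent = some p → motive p → motive b) : motive b := by
  induction b with
  | genesis => exact genesis
  | mk p n refs m s ihp _ => exact step _ p rfl ihp

theorem past_subset_of_mem_past : ∀ (b : Block) {a : Block}, a ∈ b.past → a.past ⊆ b.past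
  | genesis, a, h => by simp [past] at h
  | mk p n refs m s, a, h => by
      simp only [past, Finset.mem_union, Finset.mem_insert, Finset.mem_biUnion,
        Finset.mem_univ, true_and] at h
      intro y hy
      simp only [past, Finset.mem_union, Finset.mem_insert, Finset.mem_biUnion,
        Finset.mem_univ, true_and]
      rcases h with (rfl | h) | ⟨i, rfl | h⟩
      · exact Or.inl (Or.inr hy)
      · exact Or.inl (Or.inr (past_subset_of_mem_past p h hy))
      · exact Or.inr ⟨i, Or.inr hy⟩
      · exact Or.inr ⟨i, Or.inr (past_subset_of_mem_past (refs i) h hy)⟩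

theorem Preceq.refl (b : Block) : Preceq b b := by
  cases b <;> simp [Preceq, chain]

theorem preceq_iff_of_parent {a b p : Block} (h : b.parent = some p) :
    Preceq a b ↔ Preceq a p ∨ a = b := by
  simp [Preceq, chain_eq_of_parent h]

theorem preceq_genesis_iff {a : Block} : Preceq a genesis ↔ a = genesis := by
  simp [Preceq, chain]

theorem genesis_preceq (b : Block) : Preceq genesis b := by
  induction b using parent_induction with
  | genesis => exact Preceq.refl _
  | step b p h ih => exact (preceq_iff_of_parent h).2 (Or.inl ih)

theorem Preceq.trans {a b c : Block} (hab : Preceq a b) (hbc : Preceq b c) : Preceq a c := by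
  induction c using parent_induction with
  | genesis => rwa [preceq_genesis_iff.1 hbc] at hab
  | step c p h ih =>
    rcases (preceq_iff_of_parent h).1 hbc with h1 | rfl
    · exact (preceq_iff_of_parent h).2 (Or.inl (ih h1))
    · exact hab

theorem parent_preceq {b p : Block} (h : b.parent = some p) : Preceq p b :=
  (preceq_iff_of_parent h).2 (Or.inl (Preceq.refl p))

theorem Preceq.eq_or_mem_past {a b : Block} (hab : Preceq a b) : a = b ∨ a ∈ b.past := by
  induction b using parent_induction with
  | genesis => exact Or.inl (preceq_genesis_iff.1 hab)
  | step b p h ih =>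
    rcases (preceq_iff_of_parent h).1 hab with h1 | rfl
    · refine Or.inr ?_
      rcases ih h1 with rfl | h2
      · exact parent_mem_past h
      · exact past_subset_of_mem_past b (parent_mem_past h) h2
    · exact Or.inl rfl

theorem Preceq.past_subset {a b : Block} (hab : Preceq a b) : a.past ⊆ b.past := by
  rcases hab.eq_or_mem_past with rfl | h
  · exact subset_rfl
  · exact past_subset_of_mem_past b h

theorem Preceq.antisymm {a b : Block} (hab : Preceq a b) (hba : Preceq b a) : a = b := by
  rcases hab.eq_or_mem_past with h | h
  · exact h
  rcases hba.eq_or_mem_past with h' | h'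
  · exact h'.symm
  · exact absurd (height_lt_of_mem_past b h) (height_lt_of_mem_past a h').not_gt

theorem Preceq.total {a b c : Block} (ha : Preceq a c) (hb : Preceq b c) :
    Preceq a b ∨ Preceq b a := by
  induction c using parent_induction with
  | genesis =>
    rw [preceq_genesis_iff.1 ha]
    exact Or.inl (genesis_preceq b)
  | step c p h ih =>
    rcases (preceq_iff_of_parent h).1 ha with h1 | rfl
    · rcases (preceq_iff_of_parent h).1 hb with h2 | rfl
      · exact ih h1 h2
      · exact Or.inl ha
    · exact Or.inr hb

theorem not_preceq_parent {b p : Block} (h : b.parent = some p) : ¬ Preceq b p := fun hb =>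
  absurd (hb.past_subset (parent_mem_past h))
    fun h' => absurd (height_lt_of_mem_past p h') (lt_irrefl _)

theorem exists_child_preceq {a b : Block} (hab : Preceq a b) (hne : a ≠ b) :
    ∃ c, c.parent = some a ∧ Preceq c b := by
  induction b using parent_induction with
  | genesis => exact absurd (preceq_genesis_iff.1 hab) hne
  | step b p h ih =>
    rcases (preceq_iff_of_parent h).1 hab with h1 | h1
    · by_cases hap : a = p
      · subst hap
        exact ⟨b, h, Preceq.refl b⟩
      · obtain ⟨c, hc, hcp⟩ := ih h1 hap
        exact ⟨c, hc, hcp.trans (parent_preceq h)⟩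
    · exact absurd h1 hne

/-- The ancestors of a block are linearly ordered, and of two distinct siblings neither precedes the
other. This is what separates the subtrees of siblings. -/
theorem sibling_eq {a b c p : Block} (ha : a.parent = some p) (hb : b.parent = some p)
    (hac : Preceq a c) (hbc : Preceq b c) : a = b := by
  rcases hac.total hbc with h | h
  · rcases (preceq_iff_of_parent hb).1 h with h | h
    · exact absurd h (not_preceq_parent ha)
    · exact h
  · rcases (preceq_iff_of_parent ha).1 h with h | h
    · exact absurd h (not_preceq_parent hb)
    · exact h.symm

theorem Prec.preceq_parent {a b p : Block} (h : Prec a b) (hp : b.parent = some p) :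
    Preceq a p :=
  ((preceq_iff_of_parent hp).1 h.1).resolve_right h.2

theorem tip_chain (b : Block) : tip b.chain = b := by
  cases b <;> simp [tip, chain]

theorem nodup_chain (b : Block) : b.chain.Nodup := by
  induction b using parent_induction with
  | genesis => simp [chain]
  | step b p h ih =>
    rw [chain_eq_of_parent h]
    refine List.nodup_append.2 ⟨ih, by simp, ?_⟩
    rintro a ha c hc rfl
    simp only [List.mem_singleton] at hc
    subst hc
    exact not_preceq_parent h ha

theorem next_chain_self (b : Block) : next b.chain b = none := by
  simp only [next, List.find?_eq_none, decide_eq_true_eq]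
  intro c hc hp
  exact not_preceq_parent hp hc

theorem next_chain_of_preceq {b c t : Block} (hp : c.parent = some b) (hc : Preceq c t) :
    next t.chain b = some c := by
  cases hn : next t.chain b with
  | none =>
    simp only [next, List.find?_eq_none, decide_eq_true_eq] at hn
    exact absurd hp (hn c hc)
  | some d =>
    have h1 : Preceq d t := List.mem_of_find?_eq_some hn
    have h2 := List.find?_some hn
    simp only [decide_eq_true_eq] at h2
    rw [sibling_eq h2 hp h1 hc]

/-- Every block of `G` has its dependency blocks in `G`. -/
def PastClosed (G : Finset Block) : Prop := ∀ b ∈ G, b.past ⊆ G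

theorem PastClosed.mem_of_preceq {G : Finset Block} (hG : PastClosed G) {a b : Block}
    (hab : Preceq a b) (hb : b ∈ G) : a ∈ G := by
  rcases hab.eq_or_mem_past with rfl | h
  · exact hb
  · exact hG b hb h

theorem PastClosed.insert {G : Finset Block} (hG : PastClosed G) {b : Block}
    (hb : b.past ⊆ G) : PastClosed (insert b G) := by
  intro a ha
  rcases Finset.mem_insert.1 ha with rfl | ha
  · exact hb.trans (Finset.subset_insert _ _)
  · exact (hG a ha).trans (Finset.subset_insert _ _)

theorem pastClosed_past (b : Block) : PastClosed b.past := fun _ h => past_subset_of_mem_past b h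

/-! ### Block age -/

theorem timerHeight_mono (P : Params) {a b : Block} (h : a.past ⊆ b.past) :
    timerHeight P a ≤ timerHeight P b := by
  rw [timerHeight, timerHeight]
  refine Nat.add_le_add_right (Finset.sup_le fun x hx => ?_) 1
  simp only [Finset.mem_filter, Finset.mem_attach, true_and] at hx
  exact Finset.le_sup (f := fun x : b.past => timerHeight P x.1) (b := ⟨x.1, h x.2⟩) (by simpa using hx)

theorem maxTH_mono (P : Params) {A B : Finset Block} (h : A ⊆ B) : maxTH P A ≤ maxTH P B := by
  refine Finset.sup_mono fun x hx => ?_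
  simp only [Finset.mem_filter] at hx ⊢
  exact ⟨h hx.1, hx.2⟩

/-- The summand `1` in `timerHeight` makes the inequality strict, also when there is no timer block.
-/
theorem maxTH_lt_timerHeight (P : Params) {A : Finset Block} {b : Block} (h : A ⊆ b.past) :
    maxTH P A < timerHeight P b := by
  rw [timerHeight, Nat.lt_succ_iff]
  refine Finset.sup_le fun x hx => ?_
  simp only [Finset.mem_filter] at hx
  exact Finset.le_sup (f := fun x : b.past => timerHeight P x.1) (b := ⟨x, h hx.1⟩)
    (by simpa using hx.2)

theorem Old.mono {P : Params} {A B : Finset Block} {b : Block} (h : Old P A b) (hAB : A ⊆ B) :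
    Old P B b := by
  have : (maxTH P A : ℝ) ≤ maxTH P B := by exact_mod_cast maxTH_mono P hAB
  unfold Old at *
  linarith

theorem Old.of_preceq {P : Params} {A : Finset Block} {a b : Block} (h : Old P A b)
    (hab : Preceq a b) : Old P A a := by
  have : (timerHeight P a : ℝ) ≤ timerHeight P b := by
    exact_mod_cast timerHeight_mono P hab.past_subset
  unfold Old at *
  linarith

/-- A freshly generated honest block has `Gmin` in its past, so it cannot be old; this excludes the
new tip when the chain is extended down to the flag block. -/
theorem not_old_of_subset_past {P : Params} (hηb : 0 ≤ P.ηb) {A : Finset Block} {b : Block}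
    (h : A ⊆ b.past) : ¬ Old P A b := by
  have : (maxTH P A : ℝ) < timerHeight P b := by exact_mod_cast maxTH_lt_timerHeight P h
  unfold Old
  linarith

/-! ### Subtree weights -/

section SubtreeWeights

variable {w : Block → ℝ} {A B : Finset Block}

theorem mem_tree {x b : Block} : x ∈ tree B b ↔ x ∈ B ∧ Preceq b x := by
  simp [tree]

theorem mem_children {p : Option Block} {b : Block} :
    b ∈ children w B p ↔ b ∈ B ∧ b.parent = p ∧ 0 < w b := by
  simp [children]

theorem totalW_nonneg (hw : ∀ b, 0 ≤ w b) : 0 ≤ totalW w B := Finset.sum_nonneg fun b _ => hw b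

theorem totalW_mono (hw : ∀ b, 0 ≤ w b) (h : A ⊆ B) : totalW w A ≤ totalW w B :=
  Finset.sum_le_sum_of_subset_of_nonneg h fun b _ _ => hw b

theorem totalW_union_le (hw : ∀ b, 0 ≤ w b) : totalW w (A ∪ B) ≤ totalW w A + totalW w B := by
  have h := Finset.sum_union_inter (s₁ := A) (s₂ := B) (f := w)
  have h' := totalW_nonneg hw (B := A ∩ B)
  unfold totalW at *
  linarith

theorem totalW_union_of_disjoint (h : Disjoint A B) :
    totalW w (A ∪ B) = totalW w A + totalW w B := Finset.sum_union h

theorem totalW_insert_le (hw : ∀ b, 0 ≤ w b) (x : Block) :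
    totalW w (insert x B) ≤ w x + totalW w B := by
  rw [Finset.insert_eq]
  refine (totalW_union_le hw).trans ?_
  simp [totalW]

theorem tree_mono (h : A ⊆ B) (b : Block) : tree A b ⊆ tree B b := fun _ hx =>
  mem_tree.2 ⟨h (mem_tree.1 hx).1, (mem_tree.1 hx).2⟩

theorem tree_subset_tree {a b : Block} (h : Preceq a b) : tree B b ⊆ tree B a := fun _ hx =>
  mem_tree.2 ⟨(mem_tree.1 hx).1, h.trans (mem_tree.1 hx).2⟩

theorem subTW_nonneg (hw : ∀ b, 0 ≤ w b) (b : Block) : 0 ≤ subTW w B b := totalW_nonneg hw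

theorem subTW_mono (hw : ∀ b, 0 ≤ w b) (h : A ⊆ B) (b : Block) : subTW w A b ≤ subTW w B b :=
  totalW_mono hw (tree_mono h b)

theorem subTW_anti (hw : ∀ b, 0 ≤ w b) {a b : Block} (h : Preceq a b) :
    subTW w B b ≤ subTW w B a := totalW_mono hw (tree_subset_tree h)

theorem subTW_insert_of_preceq {x b : Block} (hx : x ∉ B) (h : Preceq b x) :
    subTW w (insert x B) b = subTW w B b + w x := by
  have : tree (insert x B) b = insert x (tree B b) := by
    ext y
    simp only [mem_tree, Finset.mem_insert]
    constructor
    · rintro ⟨h1 | h1, h2⟩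
      · exact Or.inl h1
      · exact Or.inr ⟨h1, h2⟩
    · rintro (rfl | h1)
      · exact ⟨Or.inl rfl, h⟩
      · exact ⟨Or.inr h1.1, h1.2⟩
  rw [subTW, this, totalW, Finset.sum_insert (fun h' => hx (mem_tree.1 h').1), add_comm]
  rfl

theorem subTW_insert_of_not_preceq {x b : Block} (h : ¬ Preceq b x) :
    subTW w (insert x B) b = subTW w B b := by
  have : tree (insert x B) b = tree B b := by
    ext y
    simp only [mem_tree, Finset.mem_insert]
    constructor
    · rintro ⟨rfl | h1, h2⟩
      · exact absurd h2 h
      · exact ⟨h1, h2⟩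
    · exact fun h1 => ⟨Or.inr h1.1, h1.2⟩
  rw [subTW, this]
  rfl

theorem subTW_insert_le (hw : ∀ b, 0 ≤ w b) (x b : Block) :
    subTW w (insert x B) b ≤ subTW w B b + w x := by
  by_cases hx : x ∈ B
  · rw [Finset.insert_eq_of_mem hx]
    linarith [hw x]
  by_cases h : Preceq b x
  · rw [subTW_insert_of_preceq hx h]
  · rw [subTW_insert_of_not_preceq h]
    linarith [hw x]

theorem subTW_le_add_sdiff (hw : ∀ b, 0 ≤ w b) (b : Block) :
    subTW w B b ≤ subTW w A b + subTW w (B \ A) b := by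
  refine le_trans (totalW_mono hw ?_) (totalW_union_le hw)
  intro x hx
  rw [mem_tree] at hx
  rw [Finset.mem_union, mem_tree, mem_tree, Finset.mem_sdiff]
  tauto

/-- In a past-closed set, a block outside the set has no descendants inside it. -/
theorem subTW_eq_zero (hB : PastClosed B) {b : Block} (hb : b ∉ B) : subTW w B b = 0 := by
  refine Finset.sum_eq_zero fun x hx => ?_
  rw [mem_tree] at hx
  exact absurd (hB.mem_of_preceq hx.2 hx.1) hb

/-- The condition `0 ≤ r` accounts for the default value `0` when there are no siblings; otherwise
it follows from nonnegativity of weights. All later facts on sibling weights go through this form.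
-/
theorem sibSubTW_le_iff {b : Block} {r : ℝ} (hw : ∀ b, 0 ≤ w b) :
    sibSubTW w B b ≤ r ↔
      0 ≤ r ∧ ∀ c ∈ B, c.parent = b.parent → 0 < w c → c ≠ b → subTW w B c ≤ r := by
  unfold sibSubTW
  split_ifs with h
  · rw [Finset.sup'_le_iff]
    constructor
    · intro h1
      obtain ⟨c, hc⟩ := h
      refine ⟨(subTW_nonneg hw c).trans (h1 c hc), fun d hd hp hwd hne => h1 d ?_⟩
      exact Finset.mem_erase.2 ⟨hne, mem_children.2 ⟨hd, hp, hwd⟩⟩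
    · rintro ⟨-, h1⟩ c hc
      rw [Finset.mem_erase, mem_children] at hc
      exact h1 c hc.2.1 hc.2.2.1 hc.2.2.2 hc.1
  · refine ⟨fun h0 => ⟨h0, fun c hc hp hwc hne => absurd ⟨c, ?_⟩ h⟩, fun h1 => h1.1⟩
    exact Finset.mem_erase.2 ⟨hne, mem_children.2 ⟨hc, hp, hwc⟩⟩

theorem sibSubTW_nonneg (hw : ∀ b, 0 ≤ w b) (b : Block) : 0 ≤ sibSubTW w B b :=
  ((sibSubTW_le_iff hw).1 le_rfl).1

theorem subTW_le_sibSubTW (hw : ∀ b, 0 ≤ w b) {b c : Block} (hc : c ∈ B)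
    (hp : c.parent = b.parent) (hwc : 0 < w c) (hne : c ≠ b) : subTW w B c ≤ sibSubTW w B b :=
  ((sibSubTW_le_iff hw).1 le_rfl).2 c hc hp hwc hne

theorem sibSubTW_mono (hw : ∀ b, 0 ≤ w b) (h : A ⊆ B) (b : Block) :
    sibSubTW w A b ≤ sibSubTW w B b :=
  (sibSubTW_le_iff hw).2 ⟨sibSubTW_nonneg hw b, fun _ hc hp hwc hne =>
    (subTW_mono hw h _).trans (subTW_le_sibSubTW hw (h hc) hp hwc hne)⟩

/-- Past-closedness is needed for a sibling that is itself the inserted block: before the insertion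
its subtree is empty. -/
theorem sibSubTW_insert_le (hw : ∀ b, 0 ≤ w b) (hB : PastClosed B) (x b : Block) :
    sibSubTW w (insert x B) b ≤ sibSubTW w B b + w x := by
  refine (sibSubTW_le_iff hw).2 ⟨add_nonneg (sibSubTW_nonneg hw b) (hw x), ?_⟩
  intro c hc hp hwc hne
  refine (subTW_insert_le hw x c).trans (add_le_add_left ?_ _)
  by_cases hcB : c ∈ B
  · exact subTW_le_sibSubTW hw hcB hp hwc hne
  · rw [subTW_eq_zero hB hcB]
    exact sibSubTW_nonneg hw b

/-- Adding a block that lies below no sibling of `b` does not change the weight of the siblings. -/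
theorem sibSubTW_insert_le_of_forall (hw : ∀ b, 0 ≤ w b) {x b : Block}
    (h : ∀ c, c.parent = b.parent → 0 < w c → Preceq c x → c = b) :
    sibSubTW w (insert x B) b ≤ sibSubTW w B b := by
  refine (sibSubTW_le_iff hw).2 ⟨sibSubTW_nonneg hw b, ?_⟩
  intro c hc hp hwc hne
  have hcx : ¬ Preceq c x := fun h' => hne (h c hp hwc h')
  rw [subTW_insert_of_not_preceq hcx]
  rcases Finset.mem_insert.1 hc with rfl | hc
  · exact absurd (Preceq.refl c) hcx
  · exact subTW_le_sibSubTW hw hc hp hwc hne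

theorem sibSubTW_insert_le_of_preceq (hw : ∀ b, 0 ≤ w b) {x b : Block} (hb : b ≠ genesis)
    (h : Preceq b x) : sibSubTW w (insert x B) b ≤ sibSubTW w B b := by
  obtain ⟨p, hp⟩ := exists_parent hb
  exact sibSubTW_insert_le_of_forall hw fun c hc _ hcx => sibling_eq (hc.trans hp) hp hcx h

theorem sibSubTW_insert_le_of_weight_eq_zero (hw : ∀ b, 0 ≤ w b) (hB : PastClosed B) {x b : Block}
    (hx : w x = 0) : sibSubTW w (insert x B) b ≤ sibSubTW w B b := by
  simpa [hx] using sibSubTW_insert_le hw hB x b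

/-- The lead of a child of `b` over its siblings in `L` shrinks at most by the weight of
`Y \ X` below `b` when it is measured pessimistically with respect to `X ⊆ L ⊆ Y`. -/
theorem lead_le {X L Y : Finset Block} (hw : ∀ b, 0 ≤ w b) (hL : PastClosed L)
    (hXL : X ⊆ L) (hLY : L ⊆ Y) {b c : Block} (hc : c.parent = some b) :
    subTW w L c - sibSubTW w L c ≤
      subTW w X c - sibSubTW w Y c + subTW w (Y \ X) b := by
  have key : sibSubTW w Y c ≤
      sibSubTW w L c + subTW w X c - subTW w L c + subTW w (Y \ X) b := by
    have h1 : subTW w L c ≤ subTW w X c + subTW w (L \ X) c := subTW_le_add_sdiff hw c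
    refine (sibSubTW_le_iff hw).2 ⟨?_, ?_⟩
    · have h2 : subTW w (L \ X) c ≤ subTW w (Y \ X) b :=
        (subTW_mono hw (Finset.sdiff_subset_sdiff hLY subset_rfl) c).trans
          (subTW_anti hw (parent_preceq hc))
      linarith [sibSubTW_nonneg hw c (B := L)]
    · intro d hd hp hwd hne
      have h2 : subTW w Y d ≤ subTW w L d + subTW w (Y \ L) d := subTW_le_add_sdiff hw d
      have h3 : subTW w L d ≤ sibSubTW w L c := by
        by_cases hdL : d ∈ L
        · exact subTW_le_sibSubTW hw hdL hp hwd hne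
        · rw [subTW_eq_zero hL hdL]
          exact sibSubTW_nonneg hw c
      -- What `c` loses from `L` to `X` and what its sibling `d` gains from `L` to `Y` come from
      -- disjoint parts of `Y \ X`, both below `b`, so this weight is counted only once.
      have h4 : subTW w (L \ X) c + subTW w (Y \ L) d ≤ subTW w (Y \ X) b := by
        have hdisj : Disjoint (tree (L \ X) c) (tree (Y \ L) d) := by
          rw [Finset.disjoint_left]
          intro y hy hy'
          rw [mem_tree, Finset.mem_sdiff] at hy hy'
          exact hy'.1.2 hy.1.1
        unfold subTW
        rw [← totalW_union_of_disjoint hdisj]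
        refine totalW_mono hw (Finset.union_subset ?_ ?_)
        · exact (tree_mono (Finset.sdiff_subset_sdiff hLY subset_rfl) c).trans
            (tree_subset_tree (parent_preceq hc))
        · exact (tree_mono (Finset.sdiff_subset_sdiff subset_rfl hXL) d).trans
            (tree_subset_tree (parent_preceq (hp.trans hc)))
      linarith
  linarith

end SubtreeWeights

/-! ### Block weights -/

theorem weight_of_opt {P : Params} {b : Block} (h : adapt P (weight P) b.past = .opt) :
    weight P b = 1 := by
  rw [weight_eq, h]
  rfl

theorem weight_of_con {P : Params} {b : Block} (h : adapt P (weight P) b.past = .con) :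
    weight P b = P.ηw ∨ weight P b = 0 := by
  rw [weight_eq, h]
  simp only [weightUnder]
  split_ifs <;> simp

theorem weight_cases (P : Params) (b : Block) :
    weight P b = 0 ∨ weight P b = 1 ∨ weight P b = P.ηw := by
  cases h : adapt P (weight P) b.past with
  | opt => exact Or.inr (Or.inl (weight_of_opt h))
  | con => rcases weight_of_con h with h | h <;> simp [h]

theorem weight_nonneg {P : Params} (hηw : 0 < P.ηw) (b : Block) : 0 ≤ weight P b := by
  rcases weight_cases P b with h | h | h <;> rw [h] <;> linarith

/-- Weight `1` reveals the optimistic strategy only if it differs from the heavy weight. -/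
theorem adapt_eq_opt {P : Params} {b : Block} (h : weight P b = 1) (hηw : P.ηw ≠ 1) :
    adapt P (weight P) b.past = .opt := by
  cases h' : adapt P (weight P) b.past with
  | opt => rfl
  | con => rcases weight_of_con h' with h2 | h2 <;> rw [h] at h2 <;> simp_all

/-! ### Pivot chains and the position of a valid block -/

section Pivot

variable {P : Params} {w : Block → ℝ} {L : Finset Block}

theorem bestChild_spec {b c : Block} (h : bestChild P w L b = some c) :
    c ∈ children w L (some b) ∧ ∀ d ∈ children w L (some b), subTW w L d ≤ subTW w L c := by
  unfold bestChild at h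
  simp only at h
  split_ifs at h with hne
  rw [Option.some.injEq] at h
  have := hne.choose_spec
  rw [h] at this
  simpa [and_assoc] using (Finset.mem_filter.1 (Finset.mem_filter.1 this).1)

/-- A nonempty finite set of children has one of maximal subtree weight, and among those one of
minimal digest, so the only way to have no best child is to have no child. -/
theorem children_eq_empty_of_bestChild {b : Block} (h : bestChild P w L b = none) :
    children w L (some b) = ∅ := by
  unfold bestChild at h
  simp only at h
  split_ifs at h with hne
  classical
  by_contra hch
  obtain ⟨c, hc, hmax⟩ := Finset.exists_max_image _ (subTW w L) (Finset.nonempty_iff_ne_empty.2 hch)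
  obtain ⟨d, hd, hmin⟩ := Finset.exists_min_image
    ((children w L (some b)).filter (fun c => ∀ c' ∈ children w L (some b),
      subTW w L c' ≤ subTW w L c)) (fun b => b.digest P) ⟨c, Finset.mem_filter.2 ⟨hc, hmax⟩⟩
  refine hne ⟨d, Finset.mem_filter.2 ⟨?_, fun c' hc' => hmin c' ?_⟩⟩
  · simpa using hd
  · simpa using hc'

/-- Each pivot step goes from a parent to its child, so the path visits all ancestors of each block
that it reaches. -/
theorem InPivot.of_preceq {b : Block} (h : InPivot P w L b) {c : Block} (hc : Preceq c b) :
    InPivot P w L c ∧ (c = genesis ∨ ∃ p, c.parent = some p ∧ bestChild P w L p = some c) := by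
  induction h with
  | genesis => rw [preceq_genesis_iff.1 hc]; exact ⟨.genesis, Or.inl rfl⟩
  | @step b d hb hbd ih =>
    have hp := (mem_children.1 (bestChild_spec hbd).1).2.1
    rcases (preceq_iff_of_parent hp).1 hc with h1 | rfl
    · exact ih h1
    · exact ⟨.step hb hbd, Or.inr ⟨b, hp, hbd⟩⟩

/-- A non-genesis ancestor `c` of a valid block `x` is either `x` itself, the parent of `x` being
without children in `x.past`, or a best child on the pivot chain of `x.past`. -/
theorem Valid.ancestor_cases {x b c : Block} (hx : Valid P x) (hp : c.parent = some b)
    (hc : Preceq c x) :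
    (c = x ∧ children (weight P) x.past (some b) = ∅ ∧ IsPivotTip P (weight P) x.past b) ∨
    (InPivot P (weight P) x.past c ∧ bestChild P (weight P) x.past b = some c) := by
  have hxg : x ≠ genesis := by
    rintro rfl
    exact ne_genesis_of_parent hp (preceq_genesis_iff.1 hc)
  obtain ⟨q, hq⟩ := exists_parent hxg
  have hv : IsPivotTip P (weight P) x.past q := by
    unfold Valid at hx
    rw [hq] at hx
    exact hx.2
  rcases (preceq_iff_of_parent hq).1 hc with h | rfl
  · obtain ⟨h1, h2⟩ := hv.1.of_preceq h
    refine Or.inr ⟨h1, ?_⟩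
    rcases h2 with h2 | ⟨p, h2, h3⟩
    · exact absurd h2 (ne_genesis_of_parent hp)
    · rw [hp, Option.some.injEq] at h2
      rwa [h2]
  · rw [hp, Option.some.injEq] at hq
    subst hq
    exact Or.inl ⟨rfl, children_eq_empty_of_bestChild hv.2, hv⟩

/-- Ancestors in the past are best children, and a block extending the pivot tip has no siblings
there. This provides the nonnegative lead from which the advantage of a new flag block is estimated.
-/
theorem Valid.sibSubTW_le (hw : ∀ b, 0 ≤ weight P b) {x c : Block} (hx : Valid P x)
    (hg : c ≠ genesis) (hc : Preceq c x) :
    sibSubTW (weight P) x.past c ≤ subTW (weight P) x.past c := by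
  obtain ⟨b, hp⟩ := exists_parent hg
  refine (sibSubTW_le_iff hw).2 ⟨subTW_nonneg hw c, fun d hd hdp hwd _ => ?_⟩
  have hd' : d ∈ children (weight P) x.past (some b) := mem_children.2 ⟨hd, hdp.trans hp, hwd⟩
  rcases hx.ancestor_cases hp hc with ⟨-, h, -⟩ | ⟨-, h⟩
  · rw [h] at hd'
    simp at hd'
  · exact (bestChild_spec h).2 d hd'

/-- A sibling of an ancestor of a valid block is not ahead of its siblings. -/
theorem Valid.subTW_sibling_le (hw : ∀ b, 0 ≤ weight P b) {X Y : Finset Block} {x c d : Block}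
    (hx : Valid P x) (hX : X ⊆ x.past) (hY : x.past ⊆ Y) (hp : c.parent = d.parent)
    (hg : d ≠ genesis) (hd : Preceq d x) (hne : c ≠ d) (hwc : 0 < weight P c) :
    subTW (weight P) X c ≤ sibSubTW (weight P) Y c := by
  obtain ⟨b, hb⟩ := exists_parent hg
  by_cases hc : c ∈ x.past
  swap
  · exact (subTW_mono hw hX c).trans
      ((subTW_eq_zero (pastClosed_past x) hc).trans_le (sibSubTW_nonneg hw c))
  have hc' : c ∈ children (weight P) x.past (some b) := mem_children.2 ⟨hc, hp.trans hb, hwc⟩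
  rcases hx.ancestor_cases hb hd with ⟨-, h, -⟩ | ⟨-, h⟩
  · rw [h] at hc'
    simp at hc'
  · obtain ⟨h1, h2⟩ := bestChild_spec h
    have h1 := mem_children.1 h1
    calc subTW (weight P) X c ≤ subTW (weight P) x.past c := subTW_mono hw hX c
      _ ≤ subTW (weight P) x.past d := h2 c hc'
      _ ≤ subTW (weight P) Y d := subTW_mono hw hY d
      _ ≤ sibSubTW (weight P) Y c := subTW_le_sibSubTW hw (hY h1.1) hp.symm h1.2.2 hne.symm

/-- Below an old block, the ancestors of a block generated under the optimistic strategy have a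
large lead. -/
theorem Valid.lead_of_opt {x b c : Block} (hx : Valid P x)
    (hopt : adapt P (weight P) x.past = .opt) (hold : Old P x.past b) (hp : c.parent = some b)
    (hc : Preceq c x) :
    c ∈ x.past ∧ 0 < weight P c ∧
      P.ηa ≤ subTW (weight P) x.past c - sibSubTW (weight P) x.past c := by
  have hne : x.past.Nonempty := by
    refine ⟨b, ?_⟩
    rcases (parent_preceq hp).trans hc |>.eq_or_mem_past with rfl | h
    · exact absurd hc (not_preceq_parent hp)
    · exact h
  have hn : ¬ ((∃ b p, InPivot P (weight P) x.past b ∧ b.parent = some p ∧ Old P x.past p ∧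
          subTW (weight P) x.past b - sibSubTW (weight P) x.past b < P.ηa) ∨
        ∃ b, IsPivotTip P (weight P) x.past b ∧ Old P x.past b) := by
    intro h
    rw [adapt, if_pos ⟨hne, h⟩] at hopt
    cases hopt
  rcases hx.ancestor_cases hp hc with ⟨-, -, h⟩ | ⟨h, h'⟩
  · exact absurd (Or.inr ⟨b, h, hold⟩) hn
  · have h1 := mem_children.1 (bestChild_spec h').1
    refine ⟨h1.1, h1.2.2, ?_⟩
    by_contra hlt
    exact hn (Or.inl ⟨c, b, h, hp, hold, not_le.1 hlt⟩)

end Pivot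

/-! ### Growing chains -/

/-- `b` is a block of `G` of positive weight with `0 < a b`. -/
def Leads (P : Params) (a : Block → ℝ) (G : Finset Block) (b : Block) : Prop :=
  b ∈ G ∧ 0 < weight P b ∧ 0 < a b

theorem positiveChild_eq_some {P : Params} {a : Block → ℝ} {G : Finset Block} {b c : Block}
    (h : positiveChild P a G b = some c) : c.parent = some b ∧ Leads P a G c := by
  unfold positiveChild at h
  split_ifs at h with hne
  rw [Option.some.injEq] at h
  have h1 := hne.choose_spec
  rw [h] at h1
  have h2 := mem_children.1 h1.1
  exact ⟨h2.2.1, h2.1, h2.2.2, h1.2⟩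

theorem positiveChild_eq_none {P : Params} {a : Block → ℝ} {G : Finset Block} {b : Block}
    (h : positiveChild P a G b = none) {c : Block} (hc : c.parent = some b) : ¬ Leads P a G c := by
  unfold positiveChild at h
  split_ifs at h with hne
  exact fun h' => hne ⟨c, mem_children.2 ⟨h'.1, hc, h'.2.1⟩, h'.2.2⟩

/-- Describes the truncated chain by its last block `t`. The head `b` is dropped from the grown list
because it already ends `b.chain`. In the last clause either `t` is maximal or the recursion used up
all its `n` steps; the second alternative is later excluded by counting. -/
theorem takeWhile_growChain {P : Params} {a : Block → ℝ} {G : Finset Block} {q : Block → Bool}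
    (huniq : ∀ b c d, c.parent = some b → d.parent = some b → Leads P a G c → Leads P a G d →
      c = d) (n : ℕ) (b : Block) (hb : q b = true) :
    ∃ t, Preceq b t ∧ b.chain ++ ((growChain P a G n b).takeWhile q).tail = t.chain ∧
      (growChain P a G n b).takeWhile q ≠ [] ∧
      ((growChain P a G n b).takeWhile q).head? = some b ∧
      (∀ y, Preceq y t → Preceq y b ∨ Leads P a G y ∧ q y = true) ∧
      ((∀ z, z.parent = some t → ¬ (Leads P a G z ∧ q z = true)) ∨
        b.chain.length + n ≤ t.chain.length) := by
  induction n generalizing b with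
  | zero => exact ⟨b, Preceq.refl b, by simp [growChain, hb], by simp [growChain, hb],
      by simp [growChain, hb], fun y hy => Or.inl hy, Or.inr le_rfl⟩
  | succ n ih =>
    cases hpc : positiveChild P a G b with
    | none =>
      exact ⟨b, Preceq.refl b, by simp [growChain, hb, hpc], by simp [growChain, hb, hpc],
        by simp [growChain, hb, hpc], fun y hy => Or.inl hy,
        Or.inl fun z hz h => positiveChild_eq_none hpc hz h.1⟩
    | some c =>
      obtain ⟨hcp, hcl⟩ := positiveChild_eq_some hpc
      by_cases hqc : q c = true
      · obtain ⟨t, h1, h2, h3, h4, h5, h6⟩ := ih c hqc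
        refine ⟨t, (parent_preceq hcp).trans h1, ?_, by simp [growChain, hb, hpc],
          by simp [growChain, hb, hpc], fun y hy => ?_, h6.imp id fun h => ?_⟩
        · rw [← h2, chain_eq_of_parent hcp]
          simp only [growChain, hpc, List.takeWhile_cons, hb, if_true, List.tail_cons,
            List.append_assoc, List.append_cancel_left_eq]
          cases hl : (growChain P a G n c).takeWhile q with
          | nil => exact absurd hl h3
          | cons d l =>
            rw [hl] at h4
            simp_all
        · rcases h5 y hy with h | h
          · rcases (preceq_iff_of_parent hcp).1 h with h | rfl
            · exact Or.inl h
            · exact Or.inr ⟨hcl, hqc⟩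
          · exact Or.inr h
        · rw [chain_eq_of_parent hcp, List.length_append, List.length_singleton] at h
          omega
      · have hl : (growChain P a G (n + 1) b).takeWhile q = [b] := by
          have : ∃ l, growChain P a G n c = c :: l := by
            cases n with
            | zero => exact ⟨[], rfl⟩
            | succ n =>
              simp only [growChain]
              split <;> simp
          obtain ⟨l, hl⟩ := this
          simp [growChain, hb, hpc, hl, hqc]
        refine ⟨b, Preceq.refl b, by simp [hl], by simp [hl], by simp [hl],
          fun y hy => Or.inl hy, Or.inl fun z hz h => hqc ?_⟩
        -- Only one child can lead, so if the chosen one fails the test `q`, no other choice could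
        -- have continued the chain.
        rw [← huniq b z c hz hcp h.1 hcl]
        exact h.2

theorem adv_def (P : Params) (Gmax Gmin : Finset Block) (f : Option Block) (b : Block) :
    adv P Gmax Gmin f b =
      subTW (weight P) (Gmin ∪ f.toFinset) b - sibSubTW (weight P) Gmax b := rfl

/-- At most one child has a positive advantage. -/
theorem leads_unique {P : Params} (hw : ∀ b, 0 ≤ weight P b) {Gmax Gmin : Finset Block}
    {f : Option Block} (hsub : Gmin ∪ f.toFinset ⊆ Gmax) {b c d : Block}
    (hc : c.parent = some b) (hd : d.parent = some b)
    (hcl : Leads P (adv P Gmax Gmin f) Gmax c) (hdl : Leads P (adv P Gmax Gmin f) Gmax d) :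
    c = d := by
  by_contra hne
  have h1 := subTW_le_sibSubTW hw hcl.1 (hc.trans hd.symm) hcl.2.1 hne
  have h2 := subTW_le_sibSubTW hw hdl.1 (hd.trans hc.symm) hdl.2.1 (Ne.symm hne)
  have h3 := hcl.2.2
  have h4 := hdl.2.2
  rw [adv_def] at h3 h4
  linarith [subTW_mono hw hsub c, subTW_mono hw hsub d]

/-- The chain `nextChain` consists of the ancestors of a block `t` all of which lead, and have a
large advantage if they are beyond the old tip; no child of `t` has these properties. -/
theorem exists_nextChain_eq {P : Params} (hw : ∀ b, 0 ≤ weight P b) {Gmax Gmin : Finset Block}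
    {f : Option Block} (hsub : Gmin ∪ f.toFinset ⊆ Gmax) (hg : genesis ∈ Gmax) (C : List Block) :
    ∃ t, nextChain P Gmax Gmin f C = t.chain ∧
      (∀ y, Preceq y t → y = genesis ∨ Leads P (adv P Gmax Gmin f) Gmax y ∧
        (Prec (tip C) y → (P.sm : ℝ) + P.sh < adv P Gmax Gmin f y)) ∧
      ∀ z, z.parent = some t → ¬ (Leads P (adv P Gmax Gmin f) Gmax z ∧
        (Prec (tip C) z → (P.sm : ℝ) + P.sh < adv P Gmax Gmin f z)) := by
  classical
  have hq : ∀ y, decide (¬ (Prec (tip C) y ∧ adv P Gmax Gmin f y ≤ (P.sm : ℝ) + P.sh)) = true ↔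
      (Prec (tip C) y → (P.sm : ℝ) + P.sh < adv P Gmax Gmin f y) := by
    intro y
    rw [decide_eq_true_eq, not_and, not_le]
  have hqg : ¬ (Prec (tip C) genesis ∧ adv P Gmax Gmin f genesis ≤ (P.sm : ℝ) + P.sh) := fun h =>
    h.1.2 (preceq_genesis_iff.1 h.1.1)
  obtain ⟨t, -, h2, h3, h4, h5, h6⟩ := takeWhile_growChain
    (q := fun y => decide (¬ (Prec (tip C) y ∧ adv P Gmax Gmin f y ≤ (P.sm : ℝ) + P.sh)))
    (fun b c d => leads_unique hw hsub) Gmax.card genesis (decide_eq_true hqg)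
  have h7 : ∀ y, Preceq y t → y = genesis ∨ Leads P (adv P Gmax Gmin f) Gmax y ∧
      (Prec (tip C) y → (P.sm : ℝ) + P.sh < adv P Gmax Gmin f y) := fun y hy =>
    (h5 y hy).imp preceq_genesis_iff.1 fun h => ⟨h.1, (hq y).1 h.2⟩
  refine ⟨t, ?_, h7, ?_⟩
  · have hn : nextChain P Gmax Gmin f C = List.takeWhile (fun y => decide (¬ (Prec (tip C) y ∧
        adv P Gmax Gmin f y ≤ (P.sm : ℝ) + P.sh)))
        (growChain P (adv P Gmax Gmin f) Gmax Gmax.card genesis) := by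
      unfold nextChain
      congr!
    rw [← h2, hn]
    revert h3 h4
    generalize List.takeWhile (fun y => decide (¬ (Prec (tip C) y ∧
      adv P Gmax Gmin f y ≤ (P.sm : ℝ) + P.sh)))
      (growChain P (adv P Gmax Gmin f) Gmax Gmax.card genesis) = l
    intro h3 h4
    cases l with
    | nil => exact absurd rfl h3
    | cons d l => simp_all [chain]
  · rcases h6 with h6 | h6
    · exact fun z hz h => h6 z hz ⟨h.1, (hq z).2 h.2⟩
    -- If all `Gmax.card` steps were used, the chain, including `genesis`, would have more than
    -- `Gmax.card` distinct blocks, all in `Gmax`.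
    · exfalso
      have h8 : t.chain.toFinset ⊆ Gmax := by
        intro y hy
        rcases h7 y (List.mem_toFinset.1 hy) with rfl | h
        · exact hg
        · exact h.1.1
      have h9 := Finset.card_le_card h8
      rw [List.toFinset_card_of_nodup (nodup_chain t)] at h9
      simp only [chain, List.length_singleton] at h6
      omega

/-! ### Invariants of the adversary state -/

/-- Invariants of the block sets and of the flag block. -/
structure SetInv (P : Params) (S : AdvState) : Prop where
  genesis_mem : genesis ∈ S.Gmin
  gmin_subset : S.Gmin ⊆ S.Gmax
  gmax_subset : S.Gmax ⊆ S.Ggen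
  gmin_closed : PastClosed S.Gmin
  gmax_closed : PastClosed S.Gmax
  ggen_closed : PastClosed S.Ggen
  m_subset : S.M ⊆ S.Ggen
  flag : ∀ f, S.f = some f → f ∈ S.Gmax ∧ f ∉ S.Gmin ∧ f ∉ S.M ∧ weight P f = P.ηw ∧
    0 < P.sm ∧ 0 < P.sh

/-- Invariants of the chain and of the set of special blocks. -/
structure ChainInv (P : Params) (S : AdvState) : Prop where
  chain_eq : S.C = (tip S.C).chain
  leads : ∀ y, Preceq y (tip S.C) → y = genesis ∨ Leads P (S.adv P) S.Gmax y
  adv_le : ∀ z, z.parent = some (tip S.C) → z ∈ S.Gmax → 0 < weight P z →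
    S.adv P z ≤ (P.sm : ℝ) + P.sh
  tree_subset : tree S.Gdelta (tip S.C) ∩ S.M ⊆ S.S

theorem SetInv.union_flag_subset {P : Params} {S : AdvState} (h : SetInv P S) :
    S.Gmin ∪ S.f.toFinset ⊆ S.Gmax := by
  refine Finset.union_subset h.gmin_subset fun x hx => ?_
  rw [Option.mem_toFinset, Option.mem_def] at hx
  exact (h.flag x hx).1

theorem traverse_C (P : Params) (S : AdvState) (e : Event) :
    (traverse P S e).C = nextChain P (traverse P S e).Gmax (traverse P S e).Gmin
      (traverse P S e).f S.C := rfl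

theorem traverse_S (P : Params) (S : AdvState) (e : Event) :
    (traverse P S e).S = S.S ∪ (tree (traverse P S e).Gdelta (tip (traverse P S e).C) ∩
      (traverse P S e).M) := rfl

theorem traverse_v (P : Params) (S : AdvState) (e : Event) :
    (traverse P S e).v = S.v + min (P.sm : ℝ)
      (totalW (weight P) ((traverse P S e).S \ S.S)) := rfl

/-- The invariants of the chain after an event, together with the description of the part beyond
the tip of the previous chain. -/
theorem ChainInv.of_traverse {P : Params} (hw : ∀ b, 0 ≤ weight P b) {S : AdvState} {e : Event}
    (hS : SetInv P (traverse P S e)) :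
    ChainInv P (traverse P S e) ∧
      (∀ y, Preceq y (tip (traverse P S e).C) → Prec (tip S.C) y →
        (P.sm : ℝ) + P.sh < (traverse P S e).adv P y) ∧
      ∀ b, (∀ y, Preceq y b → y = genesis ∨
        Leads P ((traverse P S e).adv P) (traverse P S e).Gmax y ∧
        (Prec (tip S.C) y → (P.sm : ℝ) + P.sh < (traverse P S e).adv P y)) →
        Preceq b (tip (traverse P S e).C) := by
  obtain ⟨t, h1, h2, h3⟩ := exists_nextChain_eq hw hS.union_flag_subset
    (hS.gmin_subset hS.genesis_mem) S.C
  rw [← traverse_C] at h1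
  have ht : tip (traverse P S e).C = t := by rw [h1, tip_chain]
  refine ⟨⟨by rw [ht, h1], fun y hy => ?_, fun z hz hzG hzw => ?_, ?_⟩, fun y hy hpy => ?_, ?_⟩
  · rw [ht] at hy
    exact (h2 y hy).imp id And.left
  · rw [ht] at hz
    by_contra hlt
    rw [not_le] at hlt
    refine h3 z hz ⟨⟨hzG, hzw, lt_of_le_of_lt (by positivity) hlt⟩, fun _ => hlt⟩
  · rw [traverse_S]
    exact Finset.subset_union_right
  · rw [ht] at hy
    rcases h2 y hy with rfl | h
    · exact absurd (preceq_genesis_iff.1 hpy.1) hpy.2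
    · exact h.2 hpy
  · intro b hb
    rw [ht]
    induction b using parent_induction with
    | genesis => exact genesis_preceq t
    | step b p hp ih =>
      have hpt := ih fun y hy => hb y (hy.trans (parent_preceq hp))
      have hbl := (hb b (Preceq.refl b)).resolve_left (ne_genesis_of_parent hp)
      by_cases hne : p = t
      · subst hne
        exact absurd hbl (h3 b hp)
      -- The next block `c` of the new chain after `p` leads and so does `b`; they coincide because
      -- at most one child leads.
      · obtain ⟨c, hc, hct⟩ := exists_child_preceq hpt hne
        have hcl := (h2 c hct).resolve_left (ne_genesis_of_parent hc)
        rwa [leads_unique hw hS.union_flag_subset hp hc hbl.1 hcl.1]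

/-- The conditions under which the events occur. -/
def Admissible (P : Params) (S : AdvState) (e : Event) : Prop :=
  match e.type with
  | .hGenRls => e.block ∉ S.Ggen ∧ S.Gmin ⊆ e.block.past ∧ e.block.past ⊆ S.Gmax ∧ Valid P e.block
  | .mGen => e.block ∉ S.Ggen ∧ e.block.past ⊆ S.Ggen
  | .mRls => e.block ∈ S.Ggen ∧ e.block ∉ S.Gmax ∧ e.block.past ⊆ S.Gmax
  | .arvl => e.block ∈ S.Gmax ∧ e.block ∉ S.Gmin ∧ e.block.past ⊆ S.Gmin

/-- If a threshold is `0`, the status is always special. As a flag is set only outside special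
status, its existence makes both thresholds positive; together with `2 * sh + 2 * sm ≤ ηw` this
separates the weight `ηw` from `1`. -/
theorem pos_of_not_spe {P : Params} (hw : ∀ b, 0 ≤ weight P b) {S : AdvState} (h : ¬ Spe P S) :
    0 < P.sm ∧ 0 < P.sh := by
  constructor <;> rw [Nat.pos_iff_ne_zero] <;> intro h0 <;> apply h
  · refine Or.inl ?_
    rw [h0, Nat.cast_zero]
    exact subTW_nonneg hw _
  · exact Or.inr (Or.inl (h0 ▸ Nat.zero_le _))

theorem nextFlag_hGenRls_cases (P : Params) (S : AdvState) (r : ℕ) (x : Block) :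
    nextFlag P S ⟨r, x, .hGenRls⟩ = S.f ∨ nextFlag P S ⟨r, x, .hGenRls⟩ = none ∨
    (nextFlag P S ⟨r, x, .hGenRls⟩ = some x ∧ weight P x = P.ηw ∧ ¬ Spe P S) := by
  simp only [nextFlag]
  split_ifs with h1 h2
  · exact Or.inr (Or.inr ⟨rfl, h1.1, h1.2.1⟩)
  · exact Or.inr (Or.inl rfl)
  · exact Or.inl rfl

theorem SetInv.of_traverse {P : Params} (hw : ∀ b, 0 ≤ weight P b) {S : AdvState} {e : Event}
    (h : SetInv P S) (he : Admissible P S e) : SetInv P (traverse P S e) := by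
  obtain ⟨h1, h2, h3, h4, h5, h6, h7, h9⟩ := h
  obtain ⟨r, x, ty⟩ := e
  cases ty with
  | hGenRls =>
    obtain ⟨e1, e2, e3, -⟩ := he
    simp only at e1 e2 e3
    refine ⟨h1, h2.trans (Finset.subset_insert _ _), Finset.insert_subset_insert _ h3, h4,
      h5.insert e3, h6.insert (e3.trans h3), h7.trans (Finset.subset_insert _ _), ?_⟩
    · intro f hf
      change nextFlag P S ⟨r, x, .hGenRls⟩ = some f at hf
      change f ∈ insert x S.Gmax ∧ f ∉ S.Gmin ∧ f ∉ S.M ∧ _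
      rcases nextFlag_hGenRls_cases P S r x with h | h | ⟨h, hx, hs⟩
      · rw [h] at hf
        obtain ⟨h10, h11⟩ := h9 f hf
        exact ⟨Finset.mem_insert_of_mem h10, h11⟩
      · simp [h] at hf
      · rw [h, Option.some.injEq] at hf
        subst hf
        exact ⟨Finset.mem_insert_self _ _, fun h' => e1 (h3 (h2 h')), fun h' => e1 (h7 h'), hx,
          pos_of_not_spe hw hs⟩
  | mGen =>
    obtain ⟨e1, e2⟩ := he
    simp only at e1 e2
    refine ⟨h1, h2, h3.trans (Finset.subset_insert _ _), h4, h5, h6.insert e2,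
      Finset.insert_subset_insert _ h7, ?_⟩
    · intro f hf
      obtain ⟨h10, h11, h12, h13⟩ := h9 f hf
      refine ⟨h10, h11, ?_, h13⟩
      change f ∉ insert x S.M
      rw [Finset.mem_insert]
      rintro (rfl | h')
      · exact e1 (h3 h10)
      · exact h12 h'
  | mRls =>
    obtain ⟨e1, e2, e3⟩ := he
    simp only at e1 e2 e3
    refine ⟨h1, h2.trans (Finset.subset_insert _ _), Finset.insert_subset e1 h3, h4,
      h5.insert e3, h6, h7, ?_⟩
    · intro f hf
      obtain ⟨h10, h11⟩ := h9 f hf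
      exact ⟨Finset.mem_insert_of_mem h10, h11⟩
  | arvl =>
    obtain ⟨e1, e2, e3⟩ := he
    simp only at e1 e2 e3
    refine ⟨Finset.mem_insert_of_mem h1, Finset.insert_subset e1 h2, h3, h4.insert e3, h5, h6, h7, ?_⟩
    intro f hf
    change nextFlag P S ⟨r, x, .arvl⟩ = some f at hf
    simp only [nextFlag] at hf
    split_ifs at hf with hfx
    obtain ⟨h10, h11, h12⟩ := h9 f hf
    refine ⟨h10, ?_, h12⟩
    change f ∉ insert x S.Gmin
    rw [Finset.mem_insert]
    rintro (rfl | h')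
    · exact hfx hf
    · exact h11 h'

/-! ### Potential values -/

/-- The value of `blockPot` at old blocks of the chain. -/
noncomputable def potVal (P : Params) (S : AdvState) (b : Block) : ℝ :=
  potWith P S b + potAdv P S (next S.C b) + potSp P S b

open Classical in
/-- The undelivered honest blocks of weight `1` below `c`. -/
noncomputable def lightSet (P : Params) (S : AdvState) (c : Block) : Finset Block :=
  tree S.Gdelta c ∩ (S.Gmax \ S.M).filter (fun b' => weight P b' = 1)

/-- Total weight of the undelivered honest blocks of weight `1` below `c`. -/
noncomputable def lightW (P : Params) (S : AdvState) (c : Block) : ℝ :=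
  totalW (weight P) (lightSet P S c)

theorem mem_lightSet {P : Params} {S : AdvState} {c y : Block} : y ∈ lightSet P S c ↔
    y ∈ S.Gdelta ∧ Preceq c y ∧ y ∈ S.Gmax \ S.M ∧ weight P y = 1 := by
  simp only [lightSet, Finset.mem_inter, mem_tree, Finset.mem_filter]
  tauto

/-- Total weight of the undelivered malicious blocks below `c` outside `X`. -/
noncomputable def specialW (P : Params) (S : AdvState) (X : Finset Block) (c : Block) : ℝ :=
  totalW (weight P) ((tree S.Gdelta c ∩ S.M) \ X)

section Potential

variable {P : Params} {S : AdvState} {e : Event}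

theorem ChainInv.potVal_tip (h : ChainInv P S) : potVal P S (tip S.C) = potWith P S (tip S.C) := by
  have : next S.C (tip S.C) = none := by
    rw [h.chain_eq, tip_chain, next_chain_self]
  simp [potVal, potAdv, potSp, this]

theorem ChainInv.potVal_child (h : ChainInv P S) {b c : Block} (hp : c.parent = some b)
    (hc : Preceq c (tip S.C)) :
    potVal P S b = potWith P S b + ((P.sh : ℝ) + P.sm - S.adv P c - min (lightW P S c) P.sh) +
      specialW P S S.S c := by
  have : next S.C b = some c := by
    rw [h.chain_eq, next_chain_of_preceq hp hc]
  simp only [potVal, potAdv, potSp, this]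
  rfl

theorem specialW_nonneg (hw : ∀ b, 0 ≤ weight P b) (X : Finset Block) (c : Block) :
    0 ≤ specialW P S X c := totalW_nonneg hw

/-- All undelivered malicious blocks below the tip were recorded in `S` when the chain was updated.
-/
theorem ChainInv.specialW_eq_zero (h : ChainInv P S) {c : Block} (hc : Preceq (tip S.C) c) :
    specialW P S S.S c = 0 := by
  unfold specialW
  rw [Finset.sdiff_eq_empty_iff_subset.2]
  · rfl
  · exact (Finset.inter_subset_inter (tree_subset_tree hc) subset_rfl).trans h.tree_subset

theorem traverse_v_le : (traverse P S e).v - S.v ≤ P.sm := by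
  rw [traverse_v]
  linarith [min_le_left (P.sm : ℝ) (totalW (weight P) ((traverse P S e).S \ S.S))]

/-- The blocks that enter `S` lie below the new tip, hence below `c`. The special part of the
potential at `c` loses their full weight, while `v` gains at most that. -/
theorem specialW_traverse_le {c : Block}
    (hc : Preceq c (tip (traverse P S e).C)) :
    specialW P (traverse P S e) (traverse P S e).S c + ((traverse P S e).v - S.v) ≤
      specialW P (traverse P S e) S.S c := by
  have h1 : (traverse P S e).v - S.v ≤ totalW (weight P) ((traverse P S e).S \ S.S) := by
    rw [traverse_v]
    linarith [min_le_right (P.sm : ℝ) (totalW (weight P) ((traverse P S e).S \ S.S))]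
  have h2 : specialW P (traverse P S e) (traverse P S e).S c +
      totalW (weight P) ((traverse P S e).S \ S.S) = specialW P (traverse P S e) S.S c := by
    unfold specialW
    rw [← totalW_union_of_disjoint]
    · congr 1
      have := tree_subset_tree (B := (traverse P S e).Gdelta) hc
      ext y
      have := @this y
      rw [traverse_S]
      simp only [Finset.mem_union, Finset.mem_sdiff, Finset.mem_inter]
      tauto
    · rw [Finset.disjoint_left]
      intro y hy hy'
      rw [Finset.mem_sdiff] at hy hy'
      exact hy.2 hy'.1
  linarith

theorem traverse_v_eq (h : tree (traverse P S e).Gdelta (tip (traverse P S e).C) ∩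
    (traverse P S e).M ⊆ S.S) : (traverse P S e).v = S.v := by
  rw [traverse_v, traverse_S, Finset.union_eq_left.2 h, sdiff_self]
  simp [totalW]

/-- If the tip does not retreat and no malicious block becomes undelivered, everything below the new
tip is already in `S`. -/
theorem ChainInv.traverse_v_eq (h : ChainInv P S)
    (ht : Preceq (tip S.C) (tip (traverse P S e).C))
    (hM : (traverse P S e).Gdelta ∩ (traverse P S e).M ⊆ S.Gdelta ∩ S.M) :
    (traverse P S e).v = S.v := by
  refine Ghast.traverse_v_eq fun y hy => h.tree_subset ?_
  rw [Finset.mem_inter, mem_tree] at hy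
  have := hM (Finset.mem_inter.2 ⟨hy.1.1, hy.2⟩)
  rw [Finset.mem_inter] at this
  exact Finset.mem_inter.2 ⟨mem_tree.2 ⟨this.1, ht.trans hy.1.2⟩, this.2⟩

/-- The chain does not grow if no advantage increases. -/
theorem ChainInv.tip_traverse_preceq (hw : ∀ b, 0 ≤ weight P b) (h : ChainInv P S)
    (hS : SetInv P S) (hS' : SetInv P (traverse P S e))
    (hadv : ∀ y, Leads P ((traverse P S e).adv P) (traverse P S e).Gmax y →
      y ∈ S.Gmax ∧ (traverse P S e).adv P y ≤ S.adv P y) :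
    Preceq (tip (traverse P S e).C) (tip S.C) := by
  obtain ⟨h1, h2, -⟩ := ChainInv.of_traverse hw hS'
  have key : ∀ y, Preceq y (tip (traverse P S e).C) → Preceq y (tip S.C) := by
    intro y
    induction y using parent_induction with
    | genesis => exact fun _ => genesis_preceq _
    | step y q hq ih =>
      intro hy
      have hqt := ih ((parent_preceq hq).trans hy)
      have hyl := (h1.leads y hy).resolve_left (ne_genesis_of_parent hq)
      obtain ⟨hyG, hya⟩ := hadv y hyl
      by_cases hne : q = tip S.C
      · have h3 := h2 y hy ⟨hne ▸ parent_preceq hq, fun h' => not_preceq_parent hq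
          (by rw [hne, h']; exact Preceq.refl _)⟩
        have h4 := h.adv_le y (hne ▸ hq) hyG hyl.2.1
        linarith
      · obtain ⟨c, hc, hct⟩ := exists_child_preceq hqt hne
        have hcl := (h.leads c hct).resolve_left (ne_genesis_of_parent hc)
        rwa [leads_unique hw hS.union_flag_subset hq hc ⟨hyG, hyl.2.1, hyl.2.2.trans_le hya⟩ hcl]
  exact key _ (Preceq.refl _)

/-- An initial part of the chain persists as long as its advantages stay positive. -/
theorem ChainInv.preceq_tip_traverse (hw : ∀ b, 0 ≤ weight P b)
    (hS' : SetInv P (traverse P S e)) {b : Block} (hb : Preceq b (tip S.C))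
    (hadv : ∀ y, Preceq y b → y = genesis ∨
      Leads P ((traverse P S e).adv P) (traverse P S e).Gmax y) :
    Preceq b (tip (traverse P S e).C) :=
  -- The cut-off concerns only blocks strictly beyond the old tip, and ancestors of the tip are not.
  (ChainInv.of_traverse hw hS').2.2 b fun y hy => (hadv y hy).imp id fun h =>
    ⟨h, fun hp => absurd (hp.1.antisymm (hy.trans hb)) hp.2⟩

/-- The first block of the old chain that is not in the new chain has lost its advantage. -/
theorem ChainInv.adv_traverse_nonpos (hw : ∀ b, 0 ≤ weight P b) (h : ChainInv P S)
    (hS' : SetInv P (traverse P S e)) (hG : S.Gmax ⊆ (traverse P S e).Gmax) {c : Block}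
    (hp : c.parent = some (tip (traverse P S e).C)) (hc : Preceq c (tip S.C)) :
    (traverse P S e).adv P c ≤ 0 := by
  by_contra hlt
  rw [not_le] at hlt
  refine not_preceq_parent hp (ChainInv.preceq_tip_traverse hw hS' hc fun y hy => ?_)
  rcases (preceq_iff_of_parent hp).1 hy with h1 | rfl
  · exact (ChainInv.of_traverse hw hS').1.leads y h1
  · have hcl := (h.leads y hc).resolve_left (ne_genesis_of_parent hp)
    exact Or.inr ⟨hG hcl.1, hcl.2.1, hlt⟩

end Potential

/-! ### Monotonicity of advantages and undelivered weights -/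

section Monotonicity

variable {P : Params} {S S' : AdvState}

theorem AdvState.adv_def (b : Block) : S.adv P b =
    subTW (weight P) (S.Gmin ∪ S.f.toFinset) b - sibSubTW (weight P) S.Gmax b := rfl

theorem AdvState.adv_of_flag_none (hf : S.f = none) (b : Block) : S.adv P b =
    subTW (weight P) S.Gmin b - sibSubTW (weight P) S.Gmax b := by
  rw [adv_def, hf, Option.toFinset_none, Finset.union_empty]

theorem lightW_mono (hw : ∀ b, 0 ≤ weight P b) (h1 : S.Gdelta ⊆ S'.Gdelta)
    (h2 : S.Gmax \ S.M ⊆ S'.Gmax \ S'.M) (c : Block) : lightW P S c ≤ lightW P S' c := by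
  refine totalW_mono hw fun y hy => ?_
  rw [mem_lightSet] at hy ⊢
  exact ⟨h1 hy.1, hy.2.1, h2 hy.2.2.1, hy.2.2.2⟩

theorem specialW_mono (hw : ∀ b, 0 ≤ weight P b) (h : S'.Gdelta ∩ S'.M ⊆ S.Gdelta ∩ S.M)
    (X : Finset Block) (c : Block) : specialW P S' X c ≤ specialW P S X c := by
  refine totalW_mono hw (Finset.sdiff_subset_sdiff (fun y hy => ?_) subset_rfl)
  rw [Finset.mem_inter, mem_tree] at hy ⊢
  have := h (Finset.mem_inter.2 ⟨hy.1.1, hy.2⟩)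
  rw [Finset.mem_inter] at this
  exact ⟨⟨this.1, hy.1.2⟩, this.2⟩

theorem lightW_nonneg (hw : ∀ b, 0 ≤ weight P b) (c : Block) : 0 ≤ lightW P S c :=
  totalW_nonneg hw

/-- A block outside `Gmax` has an empty subtree in the pessimistic graph. Thus a block that has just
entered `Gmax` cannot lead unless it becomes the flag. -/
theorem SetInv.adv_nonpos (hw : ∀ b, 0 ≤ weight P b) (h : SetInv P S) {x : Block}
    (hx : x ∉ S.Gmax) (Y : Finset Block) :
    subTW (weight P) (S.Gmin ∪ S.f.toFinset) x - sibSubTW (weight P) Y x ≤ 0 := by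
  have h1 := subTW_mono hw h.union_flag_subset x
  rw [subTW_eq_zero h.gmax_closed hx] at h1
  linarith [sibSubTW_nonneg hw (B := Y) x]

end Monotonicity

/-- Up to `d`, potential values at the blocks that were old before do not increase more than the
special value decreases. -/
def PotBound (P : Params) (S S' : AdvState) (d : ℝ) : Prop :=
  ∀ b, Preceq b (tip S'.C) → Old P S.Gmin b → ∃ b', Preceq b' b ∧ Preceq b' (tip S.C) ∧
    potVal P S' b + (S'.v - S.v) ≤ potVal P S b' + d

/-! ### Malicious generation, release and arrival -/

section Events

variable {P : Params} {S : AdvState} {r : ℕ} {x : Block}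

/-- Advantages depend on `Gmax`, `Gmin` and the flag only, so the chain and `v` stay fixed. Only the
withheld weight can grow, by at most the weight of the new block. -/
theorem potBound_mGen (hw : ∀ b, 0 ≤ weight P b) (hS : SetInv P S) (hC : ChainInv P S)
    (he : Admissible P S ⟨r, x, .mGen⟩) :
    PotBound P S (traverse P S ⟨r, x, .mGen⟩) (weight P x) := by
  have hS' := hS.of_traverse hw he
  have hC' := (ChainInv.of_traverse hw hS').1
  have hxG : x ∉ S.Ggen := he.1
  set S' := traverse P S ⟨r, x, .mGen⟩ with hS'def
  have hadv : ∀ y, S'.adv P y = S.adv P y := fun _ => rfl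
  have hGmax : S'.Gmax = S.Gmax := rfl
  have hGd : S'.Gdelta = S.Gdelta := rfl
  have hM : S'.M = insert x S.M := rfl
  have hxd : x ∉ S.Gdelta := fun h => hxG (hS.gmax_subset (Finset.mem_sdiff.1 h).1)
  have hdM : S'.Gdelta ∩ S'.M ⊆ S.Gdelta ∩ S.M := by
    rw [hGd, hM, Finset.inter_insert_of_notMem hxd]
  have ht : tip S'.C = tip S.C := by
    refine (hC.tip_traverse_preceq hw hS hS' fun y hy => ⟨hy.1, (hadv y).le⟩).antisymm ?_
    exact ChainInv.preceq_tip_traverse hw hS' (Preceq.refl _) hC.leads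
  have hv : S'.v = S.v := hC.traverse_v_eq (ht ▸ Preceq.refl _) hdM
  have hpw : ∀ b, potWith P S' b ≤ potWith P S b + weight P x := by
    intro b
    refine (subTW_mono hw ?_ b).trans (subTW_insert_le hw x b)
    intro y hy
    change y ∈ insert x S.Ggen \ S.Gmax at hy
    simp only [Finset.mem_sdiff, Finset.mem_insert] at hy ⊢
    tauto
  intro b hb _
  refine ⟨b, Preceq.refl b, ht ▸ hb, ?_⟩
  rw [hv, sub_self, add_zero]
  by_cases hbt : b = tip S'.C
  · have h1 := hC'.potVal_tip
    rw [← hbt] at h1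
    have h2 := hC.potVal_tip
    rw [← ht, ← hbt] at h2
    rw [h1, h2]
    exact hpw b
  · obtain ⟨c, hp, hc⟩ := exists_child_preceq hb hbt
    have hlight : lightW P S c ≤ lightW P S' c := by
      refine lightW_mono hw hGd.ge ?_ c
      intro y hy
      rw [hGmax, hM, Finset.mem_sdiff, Finset.mem_insert]
      rw [Finset.mem_sdiff] at hy
      refine ⟨hy.1, ?_⟩
      rintro (rfl | h)
      · exact hxG (hS.gmax_subset hy.1)
      · exact hy.2 h
    have hsp := specialW_traverse_le (P := P) (S := S) (e := ⟨r, x, .mGen⟩) hc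
    rw [← hS'def] at hsp
    have hsp' := specialW_mono hw hdM S.S c
    rw [hC'.potVal_child hp hc, hC.potVal_child hp (ht ▸ hc), hadv]
    linarith [hpw b, min_le_min_right (P.sh : ℝ) hlight]

/-- The chain can only shrink. At each ancestor `b` of `x` the withheld weight falls by the weight
of `x`; this pays either for new special weight, when `x` lies below the next chain block, or for
the advantage lost to a sibling, when it does not. -/
theorem potBound_mRls (hw : ∀ b, 0 ≤ weight P b) (hS : SetInv P S) (hC : ChainInv P S)
    (he : Admissible P S ⟨r, x, .mRls⟩) :
    PotBound P S (traverse P S ⟨r, x, .mRls⟩) 0 := by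
  have hS' := hS.of_traverse hw he
  have hC' := (ChainInv.of_traverse hw hS').1
  obtain ⟨hxG, hxm, -⟩ : x ∈ S.Ggen ∧ x ∉ S.Gmax ∧ x.past ⊆ S.Gmax := he
  have hspt := @specialW_traverse_le P S ⟨r, x, .mRls⟩
  have hvs := traverse_v_le (P := P) (S := S) (e := ⟨r, x, .mRls⟩)
  have hnonpos := fun c => hC.adv_traverse_nonpos (c := c) hw hS' (Finset.subset_insert _ _)
  have hadv : ∀ y, (traverse P S ⟨r, x, .mRls⟩).adv P y =
      subTW (weight P) (S.Gmin ∪ S.f.toFinset) y - sibSubTW (weight P) (insert x S.Gmax) y :=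
    fun _ => rfl
  have ht : Preceq (tip (traverse P S ⟨r, x, .mRls⟩).C) (tip S.C) := by
    refine hC.tip_traverse_preceq hw hS hS' fun y hy => ⟨?_, ?_⟩
    · rcases Finset.mem_insert.1 hy.1 with rfl | h
      · have h1 := hy.2.2
        rw [hadv] at h1
        linarith [hS.adv_nonpos hw hxm (insert y S.Gmax)]
      · exact h
    · rw [hadv, AdvState.adv_def]
      linarith [sibSubTW_mono hw (Finset.subset_insert x S.Gmax) y]
  have hGd : (traverse P S ⟨r, x, .mRls⟩).Gdelta = insert x S.Gmax \ S.Gmin := rfl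
  have hM : (traverse P S ⟨r, x, .mRls⟩).M = S.M := rfl
  have hpw : ∀ b, potWith P (traverse P S ⟨r, x, .mRls⟩) b =
      subTW (weight P) (S.Ggen \ insert x S.Gmax) b := fun _ => rfl
  have hGmax : (traverse P S ⟨r, x, .mRls⟩).Gmax = insert x S.Gmax := rfl
  generalize traverse P S ⟨r, x, .mRls⟩ = S' at *
  have hlight : ∀ c, lightW P S c ≤ lightW P S' c := by
    refine lightW_mono hw ?_ ?_
    · rw [hGd]
      exact Finset.sdiff_subset_sdiff (Finset.subset_insert _ _) subset_rfl
    · rw [hGmax, hM]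
      exact Finset.sdiff_subset_sdiff (Finset.subset_insert _ _) subset_rfl
  have hsplit : insert x (S.Ggen \ insert x S.Gmax) = S.Ggen \ S.Gmax := by
    ext y
    simp only [Finset.mem_sdiff, Finset.mem_insert]
    by_cases hy : y = x
    · subst hy
      tauto
    · tauto
  have hxs : x ∉ S.Ggen \ insert x S.Gmax := by simp
  have hpw1 : ∀ b, Preceq b x → potWith P S b = potWith P S' b + weight P x := by
    intro b hb
    rw [hpw, potWith, ← hsplit, subTW_insert_of_preceq hxs hb]
  have hpw2 : ∀ b, ¬ Preceq b x → potWith P S b = potWith P S' b := by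
    intro b hb
    rw [hpw, potWith, ← hsplit, subTW_insert_of_not_preceq hb]
  have hsub : ∀ c, (tree S'.Gdelta c ∩ S'.M) \ S.S ⊆
      insert x ((tree S.Gdelta c ∩ S.M) \ S.S) := by
    intro c y
    rw [hGd, hM, AdvState.Gdelta]
    simp only [Finset.mem_sdiff, Finset.mem_inter, mem_tree, Finset.mem_insert]
    tauto
  have hsp1 : ∀ c, specialW P S' S.S c ≤ specialW P S S.S c + weight P x := by
    intro c
    refine (totalW_mono hw (hsub c)).trans ((totalW_insert_le hw x).trans_eq (add_comm _ _))
  have hsp2 : ∀ c, ¬ Preceq c x → specialW P S' S.S c ≤ specialW P S S.S c := by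
    intro c hc
    refine totalW_mono hw fun y hy => ?_
    rcases Finset.mem_insert.1 (hsub c hy) with rfl | h
    · rw [Finset.mem_sdiff, Finset.mem_inter, mem_tree] at hy
      exact absurd hy.1.1.2 hc
    · exact h
  have hadv1 : ∀ c, c ≠ genesis → Preceq c x → S.adv P c ≤ S'.adv P c := by
    intro c hg hc
    rw [hadv, AdvState.adv_def]
    linarith [sibSubTW_insert_le_of_preceq hw (B := S.Gmax) hg hc]
  have hadv2 : ∀ c, S.adv P c ≤ S'.adv P c + weight P x := by
    intro c
    rw [hadv, AdvState.adv_def]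
    linarith [sibSubTW_insert_le hw hS.gmax_closed x c]
  have hadv3 : ∀ b c, c.parent = some b → ¬ Preceq b x → S.adv P c ≤ S'.adv P c := by
    intro b c hp hb
    rw [hadv, AdvState.adv_def]
    have := sibSubTW_insert_le_of_forall hw (B := S.Gmax) (x := x) (b := c) fun d hd _ hdx =>
      absurd ((parent_preceq (hd.trans hp)).trans hdx) hb
    linarith
  intro b hb _
  refine ⟨b, Preceq.refl b, hb.trans ht, ?_⟩
  rw [add_zero]
  by_cases hbt : b = tip S'.C
  · have h1 := hC'.potVal_tip
    rw [← hbt] at h1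
    rw [h1]
    by_cases hbt' : b = tip S.C
    · have h2 := hC.potVal_tip
      rw [← hbt'] at h2
      rw [h2]
      -- With the tip unchanged, `x` is the only block that can newly enter `S` below it, so the
      -- released withheld weight pays for the increase of `v`.
      have h3 := hspt hb
      have h4 := specialW_nonneg hw (S := S') S'.S b
      have h5 := hC.specialW_eq_zero (c := b) (hbt' ▸ Preceq.refl _)
      by_cases hbx : Preceq b x
      · linarith [hpw1 b hbx, hsp1 b]
      · linarith [hpw2 b hbx, hsp2 b hbx]
    · obtain ⟨c, hp, hc⟩ := exists_child_preceq (hb.trans ht) hbt'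
      -- The chain is cut at `b`. The old advantage of `c` is at most the weight released, since the
      -- new one is at most `0`; the light term is at most `sh`, so `sm` remains in the old
      -- potential to cover the increase of `v`.
      have h2 := hnonpos c (hbt ▸ hp) hc
      rw [hC.potVal_child hp hc]
      have h3 := min_le_right (lightW P S c) (P.sh : ℝ)
      have h4 := specialW_nonneg hw (S := S) S.S c
      by_cases hbx : Preceq b x
      · linarith [hpw1 b hbx, hadv2 c]
      · linarith [hpw2 b hbx, hadv3 b c hp hbx]
  · obtain ⟨c, hp, hc⟩ := exists_child_preceq hb hbt
    rw [hC'.potVal_child hp hc, hC.potVal_child hp (hc.trans ht)]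
    have h3 := hspt hc
    have h4 := min_le_min_right (P.sh : ℝ) (hlight c)
    -- Below `c`, release creates special weight without hurting the advantage; below `b` but not
    -- `c`, it hurts the advantage without creating special weight at `c`. The two costs never occur
    -- together.
    by_cases hcx : Preceq c x
    · linarith [hpw1 b ((parent_preceq hp).trans hcx), hadv1 c (ne_genesis_of_parent hp) hcx,
        hsp1 c]
    · by_cases hbx : Preceq b x
      · linarith [hpw1 b hbx, hadv2 c, hsp2 c hcx]
      · linarith [hpw2 b hbx, hadv3 b c hp hbx, hsp2 c hcx]

/-- Arrival can only raise advantages, so the old chain survives, and the light weight lost is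
covered by advantage gained. On newly reached blocks the advantage exceeds `sm + sh`, and they are
compared with the old tip, whose withheld subtree contains theirs. -/
theorem potBound_arvl (hw : ∀ b, 0 ≤ weight P b) (hηw : 2 * (P.sh : ℝ) + 2 * (P.sm : ℝ) ≤ P.ηw)
    (hS : SetInv P S) (hC : ChainInv P S) (he : Admissible P S ⟨r, x, .arvl⟩) :
    PotBound P S (traverse P S ⟨r, x, .arvl⟩) 0 := by
  have hS' := hS.of_traverse hw he
  obtain ⟨hC', hbeyond, -⟩ := ChainInv.of_traverse hw hS'
  obtain ⟨hxm, hxn, -⟩ : x ∈ S.Gmax ∧ x ∉ S.Gmin ∧ x.past ⊆ S.Gmin := he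
  have hspt := @specialW_traverse_le P S ⟨r, x, .arvl⟩
  have hvt := hC.traverse_v_eq (e := ⟨r, x, .arvl⟩)
  have hgrow := ChainInv.preceq_tip_traverse hw hS' (Preceq.refl (tip S.C))
  have hGmax : (traverse P S ⟨r, x, .arvl⟩).Gmax = S.Gmax := rfl
  have hGmin : (traverse P S ⟨r, x, .arvl⟩).Gmin = insert x S.Gmin := rfl
  have hM : (traverse P S ⟨r, x, .arvl⟩).M = S.M := rfl
  have hf : (traverse P S ⟨r, x, .arvl⟩).f = nextFlag P S ⟨r, x, .arvl⟩ := rfl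
  have hpw : ∀ b, potWith P (traverse P S ⟨r, x, .arvl⟩) b = potWith P S b := fun _ => rfl
  generalize traverse P S ⟨r, x, .arvl⟩ = S' at *
  -- When the flag itself arrives, it merely passes from the flag slot into `Gmin`, and the union
  -- does not change.
  have hun : S'.Gmin ∪ S'.f.toFinset = insert x (S.Gmin ∪ S.f.toFinset) := by
    rw [hGmin, hf, nextFlag]
    simp only
    split_ifs with h
    · rw [h]
      ext y
      simp
    · exact Finset.insert_union _ _ _
  have hadv1 : ∀ y, S.adv P y ≤ S'.adv P y := by
    intro y
    rw [AdvState.adv_def, AdvState.adv_def, hGmax, hun]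
    linarith [subTW_mono hw (Finset.subset_insert x (S.Gmin ∪ S.f.toFinset)) y]
  have hadv2 : ∀ c, Preceq c x → weight P x = 1 → S'.adv P c = S.adv P c + 1 := by
    intro c hc hx1
    -- The flag has weight `ηw ≥ 4`, hence is not a block of weight `1`.
    have hxf : x ∉ S.Gmin ∪ S.f.toFinset := by
      rw [Finset.mem_union, Option.mem_toFinset, Option.mem_def]
      rintro (h | h)
      · exact hxn h
      · obtain ⟨-, -, -, h1, h2, h3⟩ := hS.flag x h
        have h2 : (1 : ℝ) ≤ P.sm := by exact_mod_cast h2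
        have h3 : (1 : ℝ) ≤ P.sh := by exact_mod_cast h3
        linarith
    rw [AdvState.adv_def, AdvState.adv_def, hGmax, hun, subTW_insert_of_preceq hxf hc, hx1]
    ring
  have hlight : ∀ c, lightW P S c ≤ lightW P S' c + (S'.adv P c - S.adv P c) := by
    intro c
    by_cases hcx : Preceq c x ∧ weight P x = 1
    · rw [hadv2 c hcx.1 hcx.2]
      refine (totalW_mono hw (B := insert x (lightSet P S' c)) ?_).trans
        ((totalW_insert_le hw x).trans_eq ?_)
      · intro y
        simp only [mem_lightSet, Finset.mem_sdiff, Finset.mem_insert, AdvState.Gdelta, hGmax,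
          hGmin, hM]
        tauto
      · rw [hcx.2, lightW]
        ring
    · have : lightW P S c ≤ lightW P S' c := by
        refine totalW_mono hw ?_
        intro y
        simp only [mem_lightSet, Finset.mem_sdiff, Finset.mem_insert, AdvState.Gdelta, hGmax,
          hGmin, hM]
        rintro ⟨⟨h1, h2⟩, h3, h4, h5⟩
        refine ⟨⟨h1, ?_⟩, h3, h4, h5⟩
        rintro (rfl | h)
        · exact hcx ⟨h3, h5⟩
        · exact h2 h
      linarith [hadv1 c]
  have hdM : S'.Gdelta ∩ S'.M ⊆ S.Gdelta ∩ S.M := by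
    intro y
    simp only [Finset.mem_inter, Finset.mem_sdiff, Finset.mem_insert, AdvState.Gdelta, hGmax,
      hGmin, hM]
    tauto
  have ht : Preceq (tip S.C) (tip S'.C) := by
    refine hgrow fun y hy => (hC.leads y hy).imp id fun h => ⟨?_, h.2.1, ?_⟩
    · rw [hGmax]
      exact h.1
    · exact h.2.2.trans_le (hadv1 y)
  have hv : S'.v = S.v := hvt ht hdM
  rw [hv, sub_self] at hspt
  intro b hb _
  rw [hv, sub_self]
  by_cases hbt : Preceq b (tip S.C) ∧ b ≠ tip S.C
  · obtain ⟨c, hp, hc⟩ := exists_child_preceq hbt.1 hbt.2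
    refine ⟨b, Preceq.refl b, hbt.1, ?_⟩
    rw [hC'.potVal_child hp (hc.trans ht), hC.potVal_child hp hc, hpw]
    -- The cap `sh` is harmless: raising the cap by the nonnegative increase of the advantage only
    -- weakens the bound.
    have h1 : min (lightW P S c) (P.sh : ℝ) ≤
        min (lightW P S' c) P.sh + (S'.adv P c - S.adv P c) := by
      rw [← min_add_add_right]
      exact min_le_min (hlight c) (by linarith [hadv1 c])
    linarith [hspt (hc.trans ht), specialW_mono hw hdM S.S c]
  · have htb : Preceq (tip S.C) b := by
      rcases hb.total ht with h | h
      · have : b = tip S.C := by tauto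
        rw [this]
        exact Preceq.refl _
      · exact h
    refine ⟨tip S.C, htb, Preceq.refl _, ?_⟩
    rw [hC.potVal_tip]
    have h0 : potWith P S b ≤ potWith P S (tip S.C) := subTW_anti hw htb
    by_cases hbt' : b = tip S'.C
    · have h1 := hC'.potVal_tip
      rw [← hbt', hpw] at h1
      linarith
    · obtain ⟨c, hp, hc⟩ := exists_child_preceq hb hbt'
      have htc := htb.trans (parent_preceq hp)
      -- Beyond the old tip the term `sh + sm - adv` is negative, and the special weight is `0`
      -- because those blocks were recorded in `S`.
      have h1 := hbeyond c hc ⟨htc, fun h => not_preceq_parent hp (h ▸ htb)⟩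
      have h2 := le_min (lightW_nonneg hw (S := S') c) (Nat.cast_nonneg P.sh)
      rw [hC'.potVal_child hp hc, hpw]
      linarith [hspt hc, specialW_mono hw hdM S.S c, hC.specialW_eq_zero htc]

end Events

/-! ### Blocks generated by honest nodes -/

/-- The adversary state after an honest node has generated `x`. -/
noncomputable abbrev honestStep (P : Params) (S : AdvState) (r : ℕ) (x : Block) : AdvState :=
  traverse P S ⟨r, x, .hGenRls⟩

section HonestStep

variable {P : Params} {S : AdvState} {r : ℕ} {x : Block}

theorem potWith_honestStep (hx : x ∉ S.Ggen) (b : Block) :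
    potWith P (honestStep P S r x) b = potWith P S b := by
  have : insert x S.Ggen \ insert x S.Gmax = S.Ggen \ S.Gmax := by
    ext y
    simp only [Finset.mem_sdiff, Finset.mem_insert]
    by_cases hy : y = x
    · subst hy
      tauto
    · tauto
  change subTW (weight P) (insert x S.Ggen \ insert x S.Gmax) b = _
  rw [this]
  rfl

theorem gdelta_inter_honestStep (hS : SetInv P S) (hx : x ∉ S.Ggen) :
    (honestStep P S r x).Gdelta ∩ (honestStep P S r x).M ⊆ S.Gdelta ∩ S.M := by
  intro y hy
  change y ∈ (insert x S.Gmax \ S.Gmin) ∩ S.M at hy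
  simp only [AdvState.Gdelta, Finset.mem_inter, Finset.mem_sdiff, Finset.mem_insert] at hy ⊢
  obtain ⟨⟨rfl | h1, h2⟩, h3⟩ := hy
  · exact absurd (hS.m_subset h3) hx
  · exact ⟨⟨h1, h2⟩, h3⟩

theorem lightW_honestStep (hw : ∀ b, 0 ≤ weight P b) (c : Block) :
    lightW P S c ≤ lightW P (honestStep P S r x) c :=
  lightW_mono (S' := honestStep P S r x) hw (Finset.sdiff_subset_sdiff (Finset.subset_insert _ _) subset_rfl)
    (Finset.sdiff_subset_sdiff (Finset.subset_insert _ _) subset_rfl) c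

theorem lightW_honestStep_of_preceq (hw : ∀ b, 0 ≤ weight P b) (hS : SetInv P S)
    (hx : x ∉ S.Ggen) {c : Block} (hc : Preceq c x) (h1 : weight P x = 1) :
    lightW P S c + 1 ≤ lightW P (honestStep P S r x) c := by
  have hxl : x ∉ lightSet P S c := fun h =>
    hx (hS.gmax_subset (Finset.mem_sdiff.1 (mem_lightSet.1 h).2.2.1).1)
  have : insert x (lightSet P S c) ⊆ lightSet P (honestStep P S r x) c := by
    intro y hy
    rw [mem_lightSet]
    change y ∈ insert x S.Gmax \ S.Gmin ∧ Preceq c y ∧ y ∈ insert x S.Gmax \ S.M ∧ weight P y = 1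
    simp only [Finset.mem_insert, Finset.mem_sdiff]
    rcases Finset.mem_insert.1 hy with rfl | hy
    · exact ⟨⟨Or.inl rfl, fun h => hx (hS.gmax_subset (hS.gmin_subset h))⟩, hc,
        ⟨Or.inl rfl, fun h => hx (hS.m_subset h)⟩, h1⟩
    · rw [mem_lightSet, AdvState.Gdelta, Finset.mem_sdiff, Finset.mem_sdiff] at hy
      tauto
  refine le_trans (le_of_eq ?_) (totalW_mono hw this)
  rw [totalW, Finset.sum_insert hxl, h1, add_comm]
  rfl

theorem mem_honestDelta {y : Block} {a : ℝ} :
    y ∈ S.honestDelta P a ↔ (y ∈ S.Gdelta ∧ y ∉ S.M) ∧ weight P y = a := by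
  simp [AdvState.honestDelta]

theorem totalW_honestDelta (a : ℝ) :
    totalW (weight P) (S.honestDelta P a) = (S.honestDelta P a).card * a := by
  rw [totalW, Finset.sum_congr rfl fun y hy => (mem_honestDelta.1 hy).2]
  simp

theorem lightW_le_card (hw : ∀ b, 0 ≤ weight P b) (c : Block) :
    lightW P S c ≤ (S.honestDelta P 1).card := by
  have h := totalW_honestDelta (P := P) (S := S) 1
  rw [mul_one] at h
  rw [← h]
  refine totalW_mono hw fun y hy => ?_
  rw [mem_lightSet, Finset.mem_sdiff] at hy
  exact mem_honestDelta.2 ⟨⟨hy.1, hy.2.2.1.2⟩, hy.2.2.2⟩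

/-- The undelivered weight below the tip of the chain outside special status. -/
theorem subTW_gdelta_lt (hw : ∀ b, 0 ≤ weight P b) (hspe : ¬ Spe P S) {b : Block}
    (hb : Preceq (tip S.C) b) : subTW (weight P) S.Gdelta b <
      (P.sm : ℝ) + P.sh + (S.honestDelta P P.ηw).card * P.ηw := by
  rw [Spe, not_or, not_or, not_le, not_le] at hspe
  -- Weights take only the values `0`, `1`, `ηw`. Each undelivered block is therefore malicious,
  -- honest light, honest heavy or weightless, and the failure of special status bounds the
  -- malicious weight by `sm` and the light weight by `sh`.
  have h1 : tree S.Gdelta b ⊆ tree (S.Gdelta ∩ S.M) (tip S.C) ∪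
      ((S.honestDelta P 1 ∪ S.honestDelta P P.ηw) ∪
        (tree S.Gdelta b).filter (fun y => ¬ weight P y ≠ 0)) := by
    intro y hy
    simp only [Finset.mem_union, mem_tree, mem_honestDelta, Finset.mem_inter, Finset.mem_filter,
      not_not] at hy ⊢
    have h2 := weight_cases P y
    have h3 := hb.trans hy.2
    tauto
  have h2 : totalW (weight P) ((tree S.Gdelta b).filter (fun y => ¬ weight P y ≠ 0)) = 0 :=
    Finset.sum_eq_zero fun y hy => not_not.1 (Finset.mem_filter.1 hy).2
  have h3 := totalW_mono hw h1
  have h4 := totalW_union_le hw (A := tree (S.Gdelta ∩ S.M) (tip S.C))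
    (B := (S.honestDelta P 1 ∪ S.honestDelta P P.ηw) ∪
        (tree S.Gdelta b).filter (fun y => ¬ weight P y ≠ 0))
  have h5 := totalW_union_le hw (A := S.honestDelta P 1 ∪ S.honestDelta P P.ηw)
    (B := (tree S.Gdelta b).filter (fun y => ¬ weight P y ≠ 0))
  have h6 := totalW_union_le hw (A := S.honestDelta P 1) (B := S.honestDelta P P.ηw)
  have h7 : totalW (weight P) (tree (S.Gdelta ∩ S.M) (tip S.C)) < P.sm := hspe.1
  have h8 : ((S.honestDelta P 1).card : ℝ) < P.sh := by exact_mod_cast hspe.2.1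
  rw [totalW_honestDelta, totalW_honestDelta] at h6
  change totalW (weight P) (tree S.Gdelta b) < _
  linarith

/-- Without a flag block, the new block extends the chain. -/
theorem preceq_of_flag_none (hw : ∀ b, 0 ≤ weight P b) (hS : SetInv P S) (hC : ChainInv P S)
    (he : Admissible P S ⟨r, x, .hGenRls⟩) (hf : S.f = none) {c : Block}
    (hc : Preceq c (tip S.C)) : Preceq c x := by
  obtain ⟨hxG, hXL, hLY, hv⟩ : x ∉ S.Ggen ∧ S.Gmin ⊆ x.past ∧ x.past ⊆ S.Gmax ∧ Valid P x := he
  induction c using parent_induction with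
  | genesis => exact genesis_preceq x
  | step c b hp ih =>
    have hbx := ih ((parent_preceq hp).trans hc)
    have hcl := (hC.leads c hc).resolve_left (ne_genesis_of_parent hp)
    have hbG : b ∈ S.Gmax := hS.gmax_closed.mem_of_preceq (parent_preceq hp) hcl.1
    have hne : b ≠ x := fun h => hxG (hS.gmax_subset (h ▸ hbG))
    obtain ⟨d, hd, hdx⟩ := exists_child_preceq hbx hne
    by_cases hcd : c = d
    · rwa [hcd]
    · have h1 := hv.subTW_sibling_le hw hXL hLY (hp.trans hd.symm) (ne_genesis_of_parent hd) hdx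
        hcd hcl.2.1
      have h2 := hcl.2.2
      rw [AdvState.adv_of_flag_none hf] at h2
      linarith

theorem subTW_union_flag_le (hw : ∀ b, 0 ≤ weight P b) (hηw : 0 < P.ηw) (hS : SetInv P S)
    (b : Block) : subTW (weight P) (S.Gmin ∪ S.f.toFinset) b ≤ subTW (weight P) S.Gmin b + P.ηw := by
  cases hf : S.f with
  | none =>
    rw [Option.toFinset_none, Finset.union_empty]
    linarith
  | some f =>
    rw [Option.toFinset_some, Finset.union_comm, ← Finset.insert_eq,
      ← (hS.flag f hf).2.2.2.1]
    exact subTW_insert_le hw f b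

/-- A block generated under the optimistic strategy extends the old part of the chain. -/
theorem preceq_of_opt (hηw : 0 < P.ηw) (hηa : P.ηw ≤ P.ηa) (hS : SetInv P S) (hC : ChainInv P S)
    (he : Admissible P S ⟨r, x, .hGenRls⟩) (hopt : adapt P (weight P) x.past = .opt) {b c : Block}
    (hp : c.parent = some b) (hold : Old P S.Gmin b) (hc : Preceq c (tip S.C)) : Preceq c x := by
  have hw := weight_nonneg hηw
  obtain ⟨hxG, hXL, hLY, hv⟩ : x ∉ S.Ggen ∧ S.Gmin ⊆ x.past ∧ x.past ⊆ S.Gmax ∧ Valid P x := he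
  induction c using parent_induction generalizing b with
  | genesis => exact genesis_preceq x
  | step c b' hp' ih =>
    obtain rfl : b' = b := by rwa [hp', Option.some.injEq] at hp
    have hbx : Preceq b' x := by
      by_cases hbg : b' = genesis
      · rw [hbg]
        exact genesis_preceq x
      · obtain ⟨a, ha⟩ := exists_parent hbg
        exact ih ha (hold.of_preceq (parent_preceq ha)) ((parent_preceq hp).trans hc)
    have hcl := (hC.leads c hc).resolve_left (ne_genesis_of_parent hp)
    have hbG : b' ∈ S.Gmax := hS.gmax_closed.mem_of_preceq (parent_preceq hp) hcl.1
    have hne : b' ≠ x := fun h => hxG (hS.gmax_subset (h ▸ hbG))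
    obtain ⟨d, hd, hdx⟩ := exists_child_preceq hbx hne
    by_cases hcd : c = d
    · rwa [hcd]
    · exfalso
      -- A different branch `d` would lead `c` by `ηa` in `x.past`. But positive advantage of `c`
      -- leaves `d` ahead by less than the possible flag weight `ηw ≤ ηa`.
      obtain ⟨h1, h2, h3⟩ := hv.lead_of_opt hopt (hold.mono hXL) hd hdx
      have h4 := hcl.2.2
      rw [AdvState.adv_def] at h4
      have h5 := subTW_union_flag_le hw hηw hS c
      have h6 := subTW_mono hw hXL c
      have h7 := subTW_le_sibSubTW hw (hLY h1) (hd.trans hp.symm) h2 (Ne.symm hcd)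
      have h8 := subTW_mono hw hLY d
      have h9 : subTW (weight P) x.past c ≤ sibSubTW (weight P) x.past d := by
        by_cases hcL : c ∈ x.past
        · exact subTW_le_sibSubTW hw hcL (hp.trans hd.symm) hcl.2.1 hcd
        · rw [subTW_eq_zero (pastClosed_past x) hcL]
          exact sibSubTW_nonneg hw d
      linarith

/-- Without a new flag block, the advantages do not increase. -/
theorem adv_honestStep_le (hw : ∀ b, 0 ≤ weight P b)
    (hf : (honestStep P S r x).f.toFinset ⊆ S.f.toFinset) (y : Block) :
    (honestStep P S r x).adv P y ≤ S.adv P y := by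
  have h1 : subTW (weight P) ((honestStep P S r x).Gmin ∪ (honestStep P S r x).f.toFinset) y ≤
      subTW (weight P) (S.Gmin ∪ S.f.toFinset) y :=
    subTW_mono hw (Finset.union_subset_union subset_rfl hf) y
  have h2 : sibSubTW (weight P) S.Gmax y ≤ sibSubTW (weight P) (honestStep P S r x).Gmax y :=
    sibSubTW_mono hw (Finset.subset_insert _ _) y
  rw [AdvState.adv_def, AdvState.adv_def]
  linarith

theorem tip_honestStep_preceq (hw : ∀ b, 0 ≤ weight P b) (hS : SetInv P S) (hC : ChainInv P S)
    (he : Admissible P S ⟨r, x, .hGenRls⟩)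
    (hf : (honestStep P S r x).f.toFinset ⊆ S.f.toFinset) :
    Preceq (tip (honestStep P S r x).C) (tip S.C) := by
  refine hC.tip_traverse_preceq hw hS (hS.of_traverse hw he) fun y hy =>
    ⟨?_, adv_honestStep_le hw hf y⟩
  rcases Finset.mem_insert.1 hy.1 with rfl | h
  · have h1 := hy.2.2.trans_le (adv_honestStep_le hw hf y)
    have h2 := hS.adv_nonpos hw (fun h => he.1 (hS.gmax_subset h)) S.Gmax
    rw [AdvState.adv_def] at h1
    linarith
  · exact h

/-- The effect of a new honest block that leaves the flag block unchanged and extends the chain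
at `b` (or has no weight). -/
theorem potVal_honestStep_le (hw : ∀ b, 0 ≤ weight P b) (hS : SetInv P S) (hC : ChainInv P S)
    (he : Admissible P S ⟨r, x, .hGenRls⟩) (hf : (honestStep P S r x).f = S.f) {b : Block}
    (hb : Preceq b (tip (honestStep P S r x).C))
    (hbx : weight P x = 0 ∨ ∀ c, c.parent = some b → Preceq c (tip S.C) → Preceq c x) :
    potVal P (honestStep P S r x) b + ((honestStep P S r x).v - S.v) ≤ potVal P S b ∧
    (b ≠ tip S.C → weight P x = 1 → (S.honestDelta P 1).card < P.sh →
      potVal P (honestStep P S r x) b + ((honestStep P S r x).v - S.v) ≤ potVal P S b - 1) := by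
  have hS' := hS.of_traverse hw he
  have hC' := (ChainInv.of_traverse hw hS').1
  have ht := tip_honestStep_preceq hw hS hC he (hf ▸ subset_rfl)
  have hxG : x ∉ S.Ggen := he.1
  have hpw := potWith_honestStep (P := P) (S := S) (r := r) hxG b
  by_cases hbt : b = tip S.C
  · have ht' : tip (honestStep P S r x).C = tip S.C := ht.antisymm (hbt ▸ hb)
    have hv : (honestStep P S r x).v = S.v :=
      hC.traverse_v_eq (ht'.symm ▸ Preceq.refl _) (gdelta_inter_honestStep hS hxG)
    have h1 := hC'.potVal_tip
    have h2 := hC.potVal_tip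
    rw [ht', ← hbt] at h1
    rw [← hbt] at h2
    refine ⟨?_, fun h => absurd hbt h⟩
    rw [hv, h1, h2, hpw]
    linarith
  obtain ⟨c, hp, hc⟩ := exists_child_preceq (hb.trans ht) hbt
  have hadv : ∀ y, y ≠ genesis → Preceq y c → S.adv P y ≤ (honestStep P S r x).adv P y := by
    intro y hg hy
    have h1 : sibSubTW (weight P) (honestStep P S r x).Gmax y ≤ sibSubTW (weight P) S.Gmax y := by
      rcases hbx with h | h
      · exact sibSubTW_insert_le_of_weight_eq_zero hw hS.gmax_closed h
      · exact sibSubTW_insert_le_of_preceq hw hg (hy.trans (h c hp hc))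
    have h2 : (honestStep P S r x).Gmin = S.Gmin := rfl
    rw [AdvState.adv_def, AdvState.adv_def, hf, h2]
    linarith
  have hct : Preceq c (tip (honestStep P S r x).C) := by
    refine ChainInv.preceq_tip_traverse hw hS' hc fun y hy => ?_
    by_cases hg : y = genesis
    · exact Or.inl hg
    · have hyl := (hC.leads y (hy.trans hc)).resolve_left hg
      exact Or.inr ⟨Finset.mem_insert_of_mem hyl.1, hyl.2.1, hyl.2.2.trans_le (hadv y hg hy)⟩
  have h1 := specialW_traverse_le hct
  have h2 := specialW_mono hw (gdelta_inter_honestStep (r := r) hS hxG) S.S c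
  have h3 := hadv c (ne_genesis_of_parent hp) (Preceq.refl c)
  rw [hC'.potVal_child hp hct, hC.potVal_child hp hc, hpw]
  refine ⟨?_, fun _ hx1 hcard => ?_⟩
  · linarith [min_le_min_right (P.sh : ℝ) (lightW_honestStep (S := S) (r := r) (x := x) hw c)]
  · have hcx : Preceq c x := by
      rcases hbx with h | h
      · rw [h] at hx1
        norm_num at hx1
      · exact h c hp hc
    have h4 := lightW_honestStep_of_preceq (r := r) hw hS hxG hcx hx1
    have h5 := lightW_le_card (S := S) hw c
    have h6 : ((S.honestDelta P 1).card : ℝ) + 1 ≤ P.sh := by exact_mod_cast hcard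
    -- The count of light blocks is still below the cap `sh`, so the capped weight rises by the full
    -- `1`.
    have h7 : min (lightW P S c) (P.sh : ℝ) + 1 ≤ min (lightW P (honestStep P S r x) c) P.sh := by
      rw [← min_add_add_right]
      exact le_min ((min_le_left _ _).trans h4) ((min_le_left _ _).trans (by linarith))
    linarith

/-- A new honest block without effect on the flag block, the flag block being absent. -/
theorem potBound_honestStep_of_flag_none (hw : ∀ b, 0 ≤ weight P b) (hS : SetInv P S)
    (hC : ChainInv P S) (he : Admissible P S ⟨r, x, .hGenRls⟩)
    (hf : (honestStep P S r x).f = none) (hf' : S.f = none) :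
    PotBound P S (honestStep P S r x) 0 := by
  intro b hb _
  refine ⟨b, Preceq.refl b, hb.trans (tip_honestStep_preceq hw hS hC he (by simp [hf])), ?_⟩
  rw [add_zero]
  exact (potVal_honestStep_le hw hS hC he (hf.trans hf'.symm) hb
    (Or.inr fun c _ hc => preceq_of_flag_none hw hS hC he hf' hc)).1

theorem potBound_honestStep_of_weight_eq_zero (hw : ∀ b, 0 ≤ weight P b) (hS : SetInv P S)
    (hC : ChainInv P S) (he : Admissible P S ⟨r, x, .hGenRls⟩)
    (hf : (honestStep P S r x).f = S.f) (hx : weight P x = 0) :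
    PotBound P S (honestStep P S r x) 0 := by
  intro b hb _
  refine ⟨b, Preceq.refl b, hb.trans (tip_honestStep_preceq hw hS hC he (by rw [hf])), ?_⟩
  rw [add_zero]
  exact (potVal_honestStep_le hw hS hC he hf hb (Or.inl hx)).1

/-- A new block generated under the optimistic strategy. -/
theorem potBound_honestStep_of_opt (hηw : 0 < P.ηw)
    (hηa : 2 * (P.sm : ℝ) + 2 * (P.sh : ℝ) + 2 * P.ηw ≤ P.ηa) (hS : SetInv P S)
    (hC : ChainInv P S) (he : Admissible P S ⟨r, x, .hGenRls⟩)
    (hf : (honestStep P S r x).f = S.f) (hopt : adapt P (weight P) x.past = .opt) :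
    PotBound P S (honestStep P S r x) (open Classical in if Spe P S then 0 else -1) := by
  have hw := weight_nonneg hηw
  have hsm : (0 : ℝ) ≤ P.sm := Nat.cast_nonneg _
  have hsh : (0 : ℝ) ≤ P.sh := Nat.cast_nonneg _
  intro b hb hold
  have hbt := hb.trans (tip_honestStep_preceq hw hS hC he (by rw [hf]))
  have hext : ∀ c, c.parent = some b → Preceq c (tip S.C) → Preceq c x := fun c hp hc =>
    preceq_of_opt hηw (by linarith) hS hC he hopt hp hold hc
  obtain ⟨h1, h2⟩ := potVal_honestStep_le hw hS hC he hf hb (Or.inr hext)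
  refine ⟨b, Preceq.refl b, hbt, ?_⟩
  split_ifs with hspe
  · rwa [add_zero]
  refine (h2 ?_ (weight_of_opt hopt) ?_).trans_eq (sub_eq_add_neg _ _)
  swap
  · by_contra hcard
    exact hspe (Or.inr (Or.inl (not_lt.1 hcard)))
  -- The tip cannot be old here. Otherwise the child `d` of the tip towards `x` would lead by `ηa`
  -- in `x.past`, hence `ηa < adv + (sm + sh + 2 * ηw)`, whereas its advantage is at most `sm + sh`.
  -- The resulting `2 * sm + 2 * sh + 2 * ηw` is the assumed lower bound on `ηa`.
  rintro rfl
  obtain ⟨hxG, hXL, hLY, hv⟩ : x ∉ S.Ggen ∧ S.Gmin ⊆ x.past ∧ x.past ⊆ S.Gmax ∧ Valid P x := he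
  have htG : tip S.C ∈ S.Gmax := by
    rcases hC.leads _ (Preceq.refl (tip S.C)) with h | h
    · rw [h]
      exact hS.gmin_subset hS.genesis_mem
    · exact h.1
  have hne : tip S.C ≠ x := fun h => hxG (hS.gmax_subset (h ▸ htG))
  have htx : Preceq (tip S.C) x := by
    by_cases hg : tip S.C = genesis
    · rw [hg]
      exact genesis_preceq x
    · obtain ⟨a, ha⟩ := exists_parent hg
      exact preceq_of_opt (r := r) hηw (by linarith) hS hC ⟨hxG, hXL, hLY, hv⟩ hopt ha
        (hold.of_preceq (parent_preceq ha)) (Preceq.refl _)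
  obtain ⟨d, hd, hdx⟩ := exists_child_preceq htx hne
  obtain ⟨h3, h4, h5⟩ := hv.lead_of_opt hopt (hold.mono hXL) hd hdx
  have h6 := hC.adv_le d hd (hLY h3) h4
  rw [AdvState.adv_def] at h6
  have h7 := lead_le hw (pastClosed_past x) hXL hLY hd
  have h8 := subTW_mono hw (Finset.subset_union_left (s₁ := S.Gmin) (s₂ := S.f.toFinset)) d
  have h9 := subTW_gdelta_lt hw hspe (Preceq.refl _)
  have h10 : ((S.honestDelta P P.ηw).card : ℝ) ≤ 2 := by
    have : (S.honestDelta P P.ηw).card < 3 := by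
      by_contra hcard
      exact hspe (Or.inr (Or.inr (not_lt.1 hcard)))
    exact_mod_cast Nat.lt_succ_iff.1 this
  have h11 := mul_le_mul_of_nonneg_right h10 hηw.le
  rw [AdvState.Gdelta] at h9
  linarith

/-- A new heavy block that becomes the flag block. -/
theorem potBound_honestStep_flag (hηw : 0 < P.ηw) (hηb : 0 ≤ P.ηb)
    (hs : 2 * (P.sh : ℝ) + 2 * (P.sm : ℝ) ≤ P.ηw) (hS : SetInv P S)
    (hC : ChainInv P S) (he : Admissible P S ⟨r, x, .hGenRls⟩)
    (hf : (honestStep P S r x).f = some x) (hf' : S.f = none) (hx : weight P x = P.ηw)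
    (hspe : ¬ Spe P S) (hh : S.honestDelta P P.ηw = ∅) :
    PotBound P S (honestStep P S r x) (2 * (P.sh : ℝ) + 2 * P.sm - P.ηw) := by
  have hw := weight_nonneg hηw
  have hS' := hS.of_traverse hw he
  obtain ⟨hC', -, hmax⟩ := ChainInv.of_traverse hw hS'
  have htx : Preceq (tip S.C) x := preceq_of_flag_none hw hS hC he hf' (Preceq.refl _)
  obtain ⟨hxG, hXL, hLY, hv⟩ : x ∉ S.Ggen ∧ S.Gmin ⊆ x.past ∧ x.past ⊆ S.Gmax ∧ Valid P x := he
  have hsm : (0 : ℝ) ≤ P.sm := Nat.cast_nonneg _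
  have hsh : (0 : ℝ) ≤ P.sh := Nat.cast_nonneg _
  have hxn : x ∉ S.Gmin := fun h => hxG (hS.gmax_subset (hS.gmin_subset h))
  have hadv : ∀ y, y ≠ genesis → Preceq y x →
      S.adv P y + P.ηw ≤ (honestStep P S r x).adv P y := by
    intro y hg hy
    have h1 : sibSubTW (weight P) (honestStep P S r x).Gmax y ≤ sibSubTW (weight P) S.Gmax y :=
      sibSubTW_insert_le_of_preceq hw hg hy
    have h2 : (honestStep P S r x).Gmin ∪ (some x).toFinset = insert x S.Gmin := by
      rw [Option.toFinset_some, Finset.union_comm, Finset.insert_eq]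
      rfl
    rw [AdvState.adv_of_flag_none hf', AdvState.adv_def, hf, h2, subTW_insert_of_preceq hxn hy, hx]
    linarith
  -- The lead of `c` in `x.past` is nonnegative. Measuring it pessimistically costs less than `sm +
  -- sh`, as no heavy honest block is undelivered, and the flag then adds `ηw`.
  have hlarge : ∀ b c, c.parent = some b → Preceq (tip S.C) b → Preceq c x →
      P.ηw - P.sm - P.sh < (honestStep P S r x).adv P c := by
    intro b c hp hb hc
    have h1 := hadv c (ne_genesis_of_parent hp) hc
    have h2 := lead_le hw (pastClosed_past x) hXL hLY hp
    have h3 := hv.sibSubTW_le hw (ne_genesis_of_parent hp) hc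
    have h4 := subTW_gdelta_lt hw hspe hb
    rw [hh, Finset.card_empty, Nat.cast_zero, zero_mul] at h4
    rw [AdvState.adv_of_flag_none hf'] at h1
    rw [AdvState.Gdelta] at h4
    linarith
  -- Up to the old tip the earlier advantages suffice; beyond it they exceed `ηw - sm - sh ≥ sm +
  -- sh`, the cut-off value. So the chain reaches `x`, and it ends there because `x` has no
  -- descendant in `Gmax`.
  have hxt : Preceq x (tip (honestStep P S r x).C) := by
    refine hmax x fun y hy => ?_
    by_cases hg : y = genesis
    · exact Or.inl hg
    refine Or.inr ?_
    obtain ⟨q, hq⟩ := exists_parent hg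
    rcases hy.total htx with h | h
    · have hyl := (hC.leads y h).resolve_left hg
      have h1 := hadv y hg hy
      have h2 := hyl.2.2
      exact ⟨⟨Finset.mem_insert_of_mem hyl.1, hyl.2.1, by linarith⟩,
        fun hp => absurd (hp.1.antisymm h) hp.2⟩
    · by_cases hyt : y = tip S.C
      · have hyl := (hC.leads y (hyt ▸ Preceq.refl _)).resolve_left hg
        have h1 := hadv y hg hy
        have h2 := hyl.2.2
        exact ⟨⟨Finset.mem_insert_of_mem hyl.1, hyl.2.1, by linarith⟩,
          fun hp => absurd hyt.symm hp.2⟩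
      · have h1 := hlarge q y hq (Prec.preceq_parent ⟨h, Ne.symm hyt⟩ hq) hy
        refine ⟨⟨?_, ?_, by linarith⟩, fun _ => by linarith⟩
        · rcases hy.eq_or_mem_past with rfl | h2
          · exact Finset.mem_insert_self _ _
          · exact Finset.mem_insert_of_mem (hLY h2)
        · rcases hv.ancestor_cases hq hy with ⟨rfl, -⟩ | ⟨-, h2⟩
          · rw [hx]
            exact hηw
          · exact (mem_children.1 (bestChild_spec h2).1).2.2
  have htip : tip (honestStep P S r x).C = x := by
    have h1 : tip (honestStep P S r x).C ∈ insert x S.Gmax := by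
      rcases hC'.leads _ (Preceq.refl _) with h | h
      · rw [h]
        exact Finset.mem_insert_of_mem (hS.gmin_subset hS.genesis_mem)
      · exact h.1
    rcases Finset.mem_insert.1 h1 with h | h
    · exact h
    · exact absurd (hS.gmax_subset (hS.gmax_closed.mem_of_preceq hxt h)) hxG
  have hvv : (honestStep P S r x).v = S.v :=
    hC.traverse_v_eq (htip.symm ▸ htx) (gdelta_inter_honestStep hS hxG)
  intro b hb hold
  have hpw := potWith_honestStep (P := P) (S := S) (r := r) hxG b
  rw [htip] at hb
  have hbx : b ≠ x := by
    rintro rfl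
    exact not_old_of_subset_past hηb hXL hold
  obtain ⟨c, hp, hc⟩ := exists_child_preceq hb hbx
  have hct : Preceq c (tip (honestStep P S r x).C) := htip.symm ▸ hc
  have h1 := specialW_traverse_le hct
  have h2 := specialW_mono hw (gdelta_inter_honestStep (r := r) hS hxG) S.S c
  have h3 := lightW_honestStep (S := S) (r := r) (x := x) hw c
  rw [hC'.potVal_child hp hct, hpw]
  by_cases hbt : Preceq b (tip S.C) ∧ b ≠ tip S.C
  · obtain ⟨c', hp', hc'⟩ := exists_child_preceq hbt.1 hbt.2
    obtain rfl : c' = c := sibling_eq hp' hp (hc'.trans htx) hc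
    refine ⟨b, Preceq.refl b, hbt.1, ?_⟩
    rw [hC.potVal_child hp hc']
    linarith [hadv c' (ne_genesis_of_parent hp) hc, min_le_min_right (P.sh : ℝ) h3]
  · have htb : Preceq (tip S.C) b := by
      rcases hb.total htx with h | h
      · have : b = tip S.C := by tauto
        rw [this]
        exact Preceq.refl _
      · exact h
    refine ⟨tip S.C, htb, Preceq.refl _, ?_⟩
    -- On the newly reached stretch the advantage above `ηw - sm - sh` turns `sh + sm - adv` into
    -- less than `2 * sh + 2 * sm - ηw`, compared with no such term at the old tip.
    rw [hC.potVal_tip]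
    have h4 : potWith P S b ≤ potWith P S (tip S.C) := subTW_anti hw htb
    have h5 := hlarge b c hp htb hc
    have h6 := hC.specialW_eq_zero (htb.trans (parent_preceq hp))
    have h7 := le_min (lightW_nonneg hw (S := honestStep P S r x) c) hsh
    linarith

/-- A new heavy block that removes the flag block. -/
theorem potBound_honestStep_unflag (hηw : 0 < P.ηw) (hS : SetInv P S)
    (hC : ChainInv P S) (he : Admissible P S ⟨r, x, .hGenRls⟩)
    (hf : (honestStep P S r x).f = none) :
    PotBound P S (honestStep P S r x) (P.ηw + P.sm) := by
  have hw := weight_nonneg hηw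
  have hS' := hS.of_traverse hw he
  have hC' := (ChainInv.of_traverse hw hS').1
  have ht := tip_honestStep_preceq hw hS hC he (by simp [hf])
  have hnonpos := fun c => hC.adv_traverse_nonpos (c := c) hw hS' (Finset.subset_insert _ _)
  obtain ⟨hxG, hXL, hLY, hv⟩ : x ∉ S.Ggen ∧ S.Gmin ⊆ x.past ∧ x.past ⊆ S.Gmax ∧ Valid P x := he
  have hsm : (0 : ℝ) ≤ P.sm := Nat.cast_nonneg _
  -- If `x` adds nothing to a sibling of `c`, only the flag's weight can be lost. If it lies below a
  -- sibling, `c` is not ahead even pessimistically without the flag, so its old advantage came from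
  -- the flag and is at most `ηw`.
  have hadv : ∀ c, c ≠ genesis → 0 < weight P c →
      S.adv P c ≤ P.ηw ∨ S.adv P c ≤ (honestStep P S r x).adv P c + P.ηw := by
    intro c hg hwc
    have h1 := subTW_union_flag_le hw hηw hS c
    by_cases hsib : ∀ d, d.parent = c.parent → 0 < weight P d → Preceq d x → d = c
    · right
      have h2 : sibSubTW (weight P) (honestStep P S r x).Gmax c ≤ sibSubTW (weight P) S.Gmax c :=
        sibSubTW_insert_le_of_forall hw hsib
      have h3 : (honestStep P S r x).Gmin = S.Gmin := rfl
      rw [AdvState.adv_of_flag_none hf, AdvState.adv_def, h3]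
      linarith
    · left
      push Not at hsib
      obtain ⟨d, hd, -, hdx, hne⟩ := hsib
      have hdg : d ≠ genesis := by
        rintro rfl
        exact hg (parent_eq_none.1 hd.symm)
      have h2 := hv.subTW_sibling_le hw hXL hLY hd.symm hdg hdx (Ne.symm hne) hwc
      rw [AdvState.adv_def]
      linarith
  intro b hb _
  have hbt := hb.trans ht
  have hpw := potWith_honestStep (P := P) (S := S) (r := r) hxG b
  refine ⟨b, Preceq.refl b, hbt, ?_⟩
  by_cases hbt' : b = tip S.C
  · have ht' : tip (honestStep P S r x).C = tip S.C := ht.antisymm (hbt' ▸ hb)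
    have hvv : (honestStep P S r x).v = S.v :=
      hC.traverse_v_eq (ht'.symm ▸ Preceq.refl _) (gdelta_inter_honestStep hS hxG)
    have h1 := hC'.potVal_tip
    have h2 := hC.potVal_tip
    rw [ht', ← hbt'] at h1
    rw [← hbt'] at h2
    rw [hvv, h1, h2, hpw]
    linarith
  obtain ⟨c, hp, hc⟩ := exists_child_preceq hbt hbt'
  have hcl := (hC.leads c hc).resolve_left (ne_genesis_of_parent hp)
  have h0 := hadv c (ne_genesis_of_parent hp) hcl.2.1
  rw [hC.potVal_child hp hc]
  by_cases hbt'' : b = tip (honestStep P S r x).C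
  · have h1 := hC'.potVal_tip
    rw [← hbt'', hpw] at h1
    rw [h1]
    -- The chain is cut at `b`: nonpositive new advantage makes both alternatives for `c` give old
    -- advantage at most `ηw`.
    have h2 := hnonpos c (hbt'' ▸ hp) hc
    have h3 := traverse_v_le (P := P) (S := S) (e := ⟨r, x, .hGenRls⟩)
    have h4 := min_le_right (lightW P S c) (P.sh : ℝ)
    have h5 := specialW_nonneg hw (S := S) S.S c
    have h6 : S.adv P c ≤ P.ηw := by
      rcases h0 with h0 | h0 <;> linarith
    linarith
  · obtain ⟨c', hp', hc'⟩ := exists_child_preceq hb hbt''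
    obtain rfl : c' = c := sibling_eq hp' hp (hc'.trans ht) hc
    have hcl' := (hC'.leads c' hc').resolve_left (ne_genesis_of_parent hp)
    have h1 := specialW_traverse_le hc'
    have h2 := specialW_mono hw (gdelta_inter_honestStep (r := r) hS hxG) S.S c'
    have h3 := lightW_honestStep (S := S) (r := r) (x := x) hw c'
    -- While `c'` stays on the chain its new advantage is positive, so the first alternative implies
    -- the second.
    have h4 : S.adv P c' ≤ (honestStep P S r x).adv P c' + P.ηw := by
      rcases h0 with h0 | h0
      · linarith [hcl'.2.2]
      · exact h0
    rw [hC'.potVal_child hp hc', hpw]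
    linarith [min_le_min_right (P.sh : ℝ) h3]

/-- The potential after an honest node has generated a block. -/
theorem potBound_hGenRls (hηw : 0 < P.ηw) (hηb : 0 ≤ P.ηb)
    (hs : 2 * (P.sh : ℝ) + 2 * (P.sm : ℝ) ≤ P.ηw)
    (hηa : 2 * (P.sm : ℝ) + 2 * (P.sh : ℝ) + 2 * P.ηw ≤ P.ηa) (hS : SetInv P S)
    (hC : ChainInv P S) (he : Admissible P S ⟨r, x, .hGenRls⟩) :
    PotBound P S (traverse P S ⟨r, x, .hGenRls⟩) (eventValue P S ⟨r, x, .hGenRls⟩) := by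
  have hw := weight_nonneg hηw
  have hf : (honestStep P S r x).f = nextFlag P S ⟨r, x, .hGenRls⟩ := rfl
  have hlarge : 0 < P.sm → 0 < P.sh → P.ηw ≠ 1 := by
    intro h2 h3 h4
    have h2 : (1 : ℝ) ≤ P.sm := by exact_mod_cast h2
    have h3 : (1 : ℝ) ≤ P.sh := by exact_mod_cast h3
    linarith
  have hflag : S.f ≠ none → (S.honestDelta P P.ηw).Nonempty ∧ P.ηw ≠ 1 := by
    intro h
    obtain ⟨f, hf⟩ := Option.ne_none_iff_exists'.1 h
    obtain ⟨h1, h2, h3, h4, h5, h6⟩ := hS.flag f hf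
    exact ⟨⟨f, mem_honestDelta.2 ⟨⟨Finset.mem_sdiff.2 ⟨h1, h2⟩, h3⟩, h4⟩⟩, hlarge h5 h6⟩
  simp only [eventValue]
  simp only [nextFlag] at hf
  by_cases h0 : weight P x = 0
  · rw [if_pos h0]
    refine potBound_honestStep_of_weight_eq_zero hw hS hC he ?_ h0
    have h1 : (0 : ℝ) ≠ P.ηw := hηw.ne
    rw [hf]
    simp [h0, h1]
  rw [if_neg h0]
  by_cases h1 : weight P x = 1
  · rw [if_pos h1]
    -- When `ηw = 1` a block of weight `1` may come from either strategy. But then some threshold is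
    -- `0`, so the status is always special and there is never a flag.
    by_cases hηw1 : P.ηw = 1
    · have hspe : Spe P S := by
        by_contra hspe
        obtain ⟨h2, h3⟩ := pos_of_not_spe hw hspe
        exact hlarge h2 h3 hηw1
      have hf' : S.f = none := by
        by_contra h
        exact (hflag h).2 hηw1
      rw [if_pos hspe]
      refine potBound_honestStep_of_flag_none hw hS hC he ?_ hf'
      rw [hf]
      simp [hf', hspe]
    · refine potBound_honestStep_of_opt hηw hηa hS hC he ?_ (adapt_eq_opt h1 hηw1)
      rw [hf]
      simp [h1, Ne.symm hηw1]
  rw [if_neg h1]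
  have h2 : weight P x = P.ηw := by
    have := weight_cases P x
    tauto
  by_cases hh : S.honestDelta P P.ηw = ∅
  · have hf' : S.f = none := by
      by_contra h
      exact (hflag h).1.ne_empty hh
    rw [if_pos hh]
    by_cases hspe : Spe P S
    · rw [if_pos hspe]
      refine potBound_honestStep_of_flag_none hw hS hC he ?_ hf'
      rw [hf]
      simp [hf', hspe]
    · rw [if_neg hspe]
      refine potBound_honestStep_flag hηw hηb hs hS hC he ?_ hf' h2 hspe hh
      rw [hf]
      simp [h2, hspe, hh]
  · rw [if_neg hh]
    by_cases hf' : S.f = none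
    · rw [if_pos hf']
      refine potBound_honestStep_of_flag_none hw hS hC he ?_ hf'
      rw [hf]
      simp [hf', hh]
    · rw [if_neg hf']
      refine potBound_honestStep_unflag hηw hS hC he ?_
      rw [hf]
      simp [hh, h2, hf']

end HonestStep

/-! ### Executions -/

/-- The goal is `gmin_subset_view`, which puts `Gmin` into the past of an honestly generated block.
It may fail during delivery, when nodes join; `due` recovers it at the start of mining, since every
delivered block is then overdue. `genesis` is exempt because it is in `Gmin` from the outset,
whatever the delay. -/
structure ConfigInv (P : Params) {m : ℕ} (c : Config m) : Prop where
  set : SetInv P c.state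
  chain : ChainInv P c.state
  view_closed : ∀ i ∈ c.honest, PastClosed (c.view i)
  genesis_mem_view : ∀ i ∈ c.honest, genesis ∈ c.view i
  view_subset : ∀ i ∈ c.honest, c.view i ⊆ c.state.Gmax
  due : ∀ b ∈ c.state.Gmin, b = genesis ∨ c.firstSeen b + P.delay ≤ c.round
  gmin_subset_view : c.phase = .mine → ∀ i ∈ c.honest, c.state.Gmin ⊆ c.view i

variable {P : Params} {m : ℕ}

theorem configInv_initial (honest : Finset (Fin m)) :
    ConfigInv P (Config.initial honest) := by
  have hcl : PastClosed {genesis} := by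
    intro b hb
    rw [Finset.mem_singleton.1 hb, past]
    exact Finset.empty_subset _
  refine ⟨⟨Finset.mem_singleton_self _, subset_rfl, subset_rfl, hcl, hcl, hcl,
    Finset.empty_subset _, ?_⟩, ⟨rfl, ?_, ?_, ?_⟩, fun _ _ => hcl,
    fun _ _ => Finset.mem_singleton_self _, fun _ _ => subset_rfl, ?_, ?_⟩
  · intro f hf
    cases hf
  · exact fun y hy => Or.inl (preceq_genesis_iff.1 hy)
  · intro z hz hzG
    rw [Finset.mem_singleton.1 hzG] at hz
    cases hz
  · exact Finset.inter_subset_right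
  · exact fun b hb => Or.inl (Finset.mem_singleton.1 hb)
  · intro h
    cases h

theorem subset_of_view_update {c : Config m} {i j : Fin m} {b : Block} {A : Finset Block}
    (h : A ⊆ c.view j) : A ⊆ Function.update c.view i (insert b (c.view i)) j := by
  by_cases hj : j = i
  · subst hj
    rw [Function.update_self]
    exact h.trans (Finset.subset_insert _ _)
  · rwa [Function.update_of_ne hj]

theorem view_update_subset {c : Config m} {i j : Fin m} {b : Block} {A : Finset Block}
    (h : c.view j ⊆ A) (hb : b ∈ A) : Function.update c.view i (insert b (c.view i)) j ⊆ A := by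
  by_cases hj : j = i
  · subst hj
    rw [Function.update_self]
    exact Finset.insert_subset hb h
  · rwa [Function.update_of_ne hj]

theorem pastClosed_view_update {c : Config m} {i j : Fin m} {b : Block}
    (h : PastClosed (c.view j)) (hb : b.past ⊆ c.view i) :
    PastClosed (Function.update c.view i (insert b (c.view i)) j) := by
  by_cases hj : j = i
  · subst hj
    rw [Function.update_self]
    exact h.insert hb
  · rwa [Function.update_of_ne hj]

theorem due_update {c : Config m} {x : Block} {n : ℕ} (hx : x ∉ c.state.Gmin)
    (h : ∀ b ∈ c.state.Gmin, b = genesis ∨ c.firstSeen b + P.delay ≤ c.round) :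
    ∀ b ∈ c.state.Gmin, b = genesis ∨ Function.update c.firstSeen x n b + P.delay ≤ c.round := by
  intro b hb
  have hbx : b ≠ x := by
    rintro rfl
    exact hx hb
  rw [Function.update_of_ne hbx]
  exact h b hb

/-- Every event of an execution satisfies the conditions of its type. -/
theorem Step.admissible {c c' : Config m} {e : Event} (hc : ConfigInv P c)
    (h : Step P c (some e) c') : Admissible P c.state e ∧ c'.state = traverse P c.state e := by
  cases h with
  | release i b hphase hi hb hnew hpast =>
    exact ⟨⟨hb, hnew, hpast.trans (hc.view_subset i hi)⟩, rfl⟩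
  | arrive b hphase hb hnew hdue hall hpast => exact ⟨⟨hb, hnew, hpast⟩, rfl⟩
  | honestGenerate i b hphase hi hnew hpast hvalid =>
    refine ⟨⟨hnew, ?_, ?_, hvalid⟩, rfl⟩
    · change _ ⊆ b.past
      rw [hpast]
      exact hc.gmin_subset_view hphase i hi
    · change b.past ⊆ _
      rw [hpast]
      exact hc.view_subset i hi
  | maliciousGenerate b hphase hnew hpast hvalid => exact ⟨⟨hnew, hpast⟩, rfl⟩

theorem ConfigInv.step (hηw : 0 < P.ηw) {c c' : Config m} {e : Option Event}
    (hc : ConfigInv P c) (h : Step P c e c') : ConfigInv P c' := by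
  have hw := weight_nonneg hηw
  have hstate : SetInv P c'.state ∧ ChainInv P c'.state := by
    cases e with
    | none =>
      have : c'.state = c.state := by cases h <;> rfl
      rw [this]
      exact ⟨hc.set, hc.chain⟩
    | some e =>
      obtain ⟨h1, h2⟩ := h.admissible hc
      rw [h2]
      have h3 := hc.set.of_traverse hw h1
      exact ⟨h3, (ChainInv.of_traverse hw h3).1⟩
  obtain ⟨h1, h2⟩ := hstate
  cases h with
  | newRound honest' view' hphase hkeep hjoin =>
    refine ⟨h1, h2, fun i hi => ?_, fun i hi => ?_, fun i hi => ?_,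
      fun b hb => (hc.due b hb).imp id fun h => Nat.le_succ_of_le h, fun h => by cases h⟩
    all_goals by_cases hi' : i ∈ c.honest
    · have := hc.view_closed i hi'
      rwa [← hkeep i hi hi'] at this
    · exact fun b hb => ((hjoin i hi hi').1 b hb).2
    · have := hc.genesis_mem_view i hi'
      rwa [← hkeep i hi hi'] at this
    · exact (hjoin i hi hi').2.1
    · have := hc.view_subset i hi'
      rwa [← hkeep i hi hi'] at this
    · exact (hjoin i hi hi').2.2
  | deliver i b hphase hi hb hpast =>
    exact ⟨h1, h2, fun j hj => pastClosed_view_update (hc.view_closed j hj) hpast,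
      fun j hj => subset_of_view_update (Finset.singleton_subset_iff.2 (hc.genesis_mem_view j hj))
        (Finset.mem_singleton_self _),
      fun j hj => view_update_subset (hc.view_subset j hj) hb, hc.due,
      fun h => absurd (hphase.symm.trans h) (by simp)⟩
  | release i b hphase hi hb hnew hpast =>
    exact ⟨h1, h2, fun j hj => pastClosed_view_update (hc.view_closed j hj) hpast,
      fun j hj => subset_of_view_update (Finset.singleton_subset_iff.2 (hc.genesis_mem_view j hj))
        (Finset.mem_singleton_self _),
      fun j hj => view_update_subset ((hc.view_subset j hj).trans (Finset.subset_insert _ _))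
        (Finset.mem_insert_self _ _),
      due_update (fun h => hnew (hc.set.gmin_subset h)) hc.due,
      fun h => absurd (hphase.symm.trans h) (by simp)⟩
  | arrive b hphase hb hnew hdue hall hpast =>
    refine ⟨h1, h2, hc.view_closed, hc.genesis_mem_view, hc.view_subset, fun y hy => ?_,
      fun h => absurd (hphase.symm.trans h) (by simp)⟩
    rcases Finset.mem_insert.1 hy with rfl | hy
    · exact Or.inr hdue
    · exact hc.due y hy
  | startMining hphase hdue =>
    refine ⟨h1, h2, hc.view_closed, hc.genesis_mem_view, hc.view_subset, hc.due,
      fun _ i hi b hb => ?_⟩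
    -- A block of `Gmin` is past its deadline, so the rule that ends delivery places it in every
    -- honest view, including those of newly joined nodes.
    rcases hc.due b hb with rfl | h
    · exact hc.genesis_mem_view i hi
    · exact (hdue b (hc.set.gmin_subset hb) h).2 i hi
  | honestGenerate i b hphase hi hnew hpast hvalid =>
    exact ⟨h1, h2, fun j hj => pastClosed_view_update (hc.view_closed j hj) hpast.le,
      fun j hj => subset_of_view_update (Finset.singleton_subset_iff.2 (hc.genesis_mem_view j hj))
        (Finset.mem_singleton_self _),
      fun j hj => view_update_subset ((hc.view_subset j hj).trans (Finset.subset_insert _ _))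
        (Finset.mem_insert_self _ _),
      due_update (fun h => hnew (hc.set.gmax_subset (hc.set.gmin_subset h))) hc.due,
      fun h j hj => subset_of_view_update (hc.gmin_subset_view hphase j hj)⟩
  | maliciousGenerate b hphase hnew hpast hvalid =>
    exact ⟨h1, h2, hc.view_closed, hc.genesis_mem_view, hc.view_subset, hc.due,
      hc.gmin_subset_view⟩

theorem Reachable.configInv (hηw : 0 < P.ηw) {c : Config m} (h : Reachable P c) :
    ConfigInv P c := by
  induction h with
  | initial honest => exact configInv_initial honest
  | step _ hs ih => exact ih.step hηw hs

/-! ### The global potential -/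

theorem ChainInv.mem_chain {S : AdvState} (h : ChainInv P S) {b : Block} :
    b ∈ S.C ↔ Preceq b (tip S.C) := by
  conv_lhs => rw [h.chain_eq]
  rfl

theorem blockPot_eq_some {S : AdvState} {b : Block} {a : ℝ} :
    blockPot P S b = some a ↔ (b ∈ S.C ∧ Old P S.Gmin b) ∧ potVal P S b = a := by
  unfold blockPot
  split_ifs with h
  · rw [Option.some.injEq]
    exact ⟨fun h' => ⟨h, h'⟩, fun h' => h'.2⟩
  · simp [h]

theorem le_globalPot {S : AdvState} {B : Finset Block} {b : Block} (hb : b ∈ S.C)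
    (hB : ¬ B ⊆ b.past) (hold : Old P S.Gmin b) : potVal P S b ≤ globalPot P S B := by
  classical
  have hmem : potVal P S b ∈ (S.C.toFinset.filter (fun b => ¬ B ⊆ b.past)).biUnion
      (fun b => (blockPot P S b).toFinset) := by
    rw [Finset.mem_biUnion]
    exact ⟨b, by simp [hb, hB], by simp [blockPot_eq_some, hb, hold]⟩
  unfold globalPot
  simp only
  split_ifs with h
  · refine Finset.le_max' _ _ ?_
    convert hmem
  · exact absurd ⟨_, by convert hmem⟩ h

/-- The block `b` serves only as a witness that some value is defined, so that `globalPot` is an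
attained maximum and not the default `0`. -/
theorem exists_globalPot_eq {S : AdvState} {B : Finset Block} {b : Block} (hb : b ∈ S.C)
    (hB : ¬ B ⊆ b.past) (hold : Old P S.Gmin b) :
    ∃ a ∈ S.C, ¬ B ⊆ a.past ∧ blockPot P S a = some (globalPot P S B) := by
  classical
  have hmem : potVal P S b ∈ (S.C.toFinset.filter (fun b => ¬ B ⊆ b.past)).biUnion
      (fun b => (blockPot P S b).toFinset) := by
    rw [Finset.mem_biUnion]
    exact ⟨b, by simp [hb, hB], by simp [blockPot_eq_some, hb, hold]⟩
  unfold globalPot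
  simp only
  split_ifs with h
  · have := Finset.max'_mem _ h
    rw [Finset.mem_biUnion] at this
    obtain ⟨a, ha, ha'⟩ := this
    refine ⟨a, ?_, ?_, by simpa using ha'⟩
    · simp only [Finset.mem_filter, List.mem_toFinset] at ha
      exact ha.1
    · simp only [Finset.mem_filter, List.mem_toFinset] at ha
      exact ha.2
  · exact absurd ⟨_, by convert hmem⟩ h

theorem gmin_subset_traverse (S : AdvState) (e : Event) : S.Gmin ⊆ (traverse P S e).Gmin := by
  obtain ⟨r, x, ty⟩ := e
  cases ty
  case arvl => exact Finset.subset_insert _ _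
  all_goals exact subset_rfl

theorem potBound_traverse (hηw : 0 < P.ηw) (hηb : 0 ≤ P.ηb)
    (hs : 2 * (P.sh : ℝ) + 2 * (P.sm : ℝ) ≤ P.ηw)
    (hηa : 2 * (P.sm : ℝ) + 2 * (P.sh : ℝ) + 2 * P.ηw ≤ P.ηa) {S : AdvState} {e : Event}
    (hS : SetInv P S) (hC : ChainInv P S) (he : Admissible P S e) :
    PotBound P S (traverse P S e) (eventValue P S e) := by
  have hw := weight_nonneg hηw
  obtain ⟨r, x, ty⟩ := e
  cases ty with
  | hGenRls => exact potBound_hGenRls hηw hηb hs hηa hS hC he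
  | mGen => exact potBound_mGen hw hS hC he
  | mRls => exact potBound_mRls hw hS hC he
  | arvl => exact potBound_arvl hw hs hS hC he

end Ghast

/-! ### Comparison of the maximal potentials before and after the event -/

theorem mainTheorem3 (P : Ghast.Params)
    (hηw : 0 < P.ηw) (hηb : 0 ≤ P.ηb)
    (hs : 2 * (P.sh : ℝ) + 2 * (P.sm : ℝ) ≤ P.ηw)
    (hηa : 2 * (P.sm : ℝ) + 2 * (P.sh : ℝ) + 2 * P.ηw ≤ P.ηa)
    {m : ℕ} (c c' : Ghast.Config m) (e : Ghast.Event)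
    (hc : Ghast.Reachable P c) (hstep : Ghast.Step P c (some e) c')
    (B : Finset Ghast.Block) (hB : Ghast.IsGraph P B) (hBne : B.Nonempty)
    (hgenesis : Ghast.Old P c.state.Gmin Ghast.Block.genesis)
    (hexc : ∀ b ∈ c'.state.C, ¬ B ⊆ b.past →
      ¬ Ghast.Old P c'.state.Gmin b ∨ Ghast.Old P c.state.Gmin b ∨
        Ghast.blockPot P c'.state b ≠ some (Ghast.globalPot P c'.state B)) :
    (Ghast.globalPot P c'.state B + c'.state.v) - (Ghast.globalPot P c.state B + c.state.v)
      ≤ Ghast.eventValue P c.state e := by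
  have hinv := hc.configInv hηw
  have hinv' := hinv.step hηw hstep
  obtain ⟨he, hst⟩ := hstep.admissible hinv
  have hbound := Ghast.potBound_traverse hηw hηb hs hηa hinv.set hinv.chain he
  rw [← hst] at hbound
  have hgB : ¬ B ⊆ Ghast.Block.genesis.past := by
    intro h
    obtain ⟨b, hb⟩ := hBne
    simpa [Ghast.Block.past] using h hb
  have hmono : c.state.Gmin ⊆ c'.state.Gmin := by
    rw [hst]
    exact Ghast.gmin_subset_traverse _ _
  -- `genesis` is on the chain, is old, and has empty past, so the maximum is attained at some `b`.
  obtain ⟨b, hbC, hbB, hbpot⟩ := Ghast.exists_globalPot_eq (S := c'.state)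
    (hinv'.chain.mem_chain.2 (Ghast.genesis_preceq _)) hgB (hgenesis.mono hmono)
  obtain ⟨⟨-, hold'⟩, hval⟩ := Ghast.blockPot_eq_some.1 hbpot
  -- A maximiser that has just become old is exactly what `hexc` rules out.
  have hold : Ghast.Old P c.state.Gmin b := by
    rcases hexc b hbC hbB with h | h | h
    · exact absurd hold' h
    · exact h
    · exact absurd hbpot h
  obtain ⟨a, hab, hat, hle⟩ := hbound b (hinv'.chain.mem_chain.1 hbC) hold
  -- The ancestor `a` inherits age from `b`, and its smaller past cannot contain `B` either, so it
  -- counts in the old maximum.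
  have hle' := Ghast.le_globalPot (hinv.chain.mem_chain.2 hat)
    (fun h => hbB (h.trans hab.past_subset)) (hold.of_preceq hab)
  linarith
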